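/- **Setting.** A problem with $K\ge 3$ arms is a vector $\nu=(\nu_1,\dots,\nu_K)$ of probability distributions on $\mathbb R$ with means $\mu_k$; $\tau\in\mathbb R$ is a known threshold. In each of $T$ rounds a (possibly randomized) strategy $\pi$ picks an arm, depending on what it has observed so far, and observes a reward drawn from the distribution of that arm, conditionally independently of the past. After round $T$ it outputs $\widehat Q\in\{-1,1\}^K$. Let $Q_k=1$ if $\mu_k\ge\tau$ and $Q_k=-1$ otherwise. The expected simple regret is $$\bar R_T^{\nu,\pi}=\mathbb E_\nu\Big[\max_{k:\ \widehat Q_k\ne Q_k}|\tau-\mu_k|\Big]\qquad(\max\emptyset=0),$$ and the minimax regret over a class $\mathcal B$ is $\bar R_T^*(\mathcal B)=\inf_\pi\sup_{\nu\in\mathcal B}\bar R_T^{\nu,\pi}$. Let $\mathcal B_s$ be the class of problems with $\mu_1\le\dots\le\mu_K$ and all $\nu_k$ supported in $[0,1]$. For $\sigma>0$ let $\mathcal B_s^\sigma$ be the class of problems with $\mu_1\le\dots\le\mu_K$ and all $\nu_k$ $\sigma^2$-sub-Gaussian, i.e. $\mathbb E_{X\sim\nu_k}e^{t(X-\mu_k)}\le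 e^{\sigma^2t^2/2}$ for all $t\in\mathbb R$. **The algorithm MTB with parameter $\sigma$.** Put $T_1=\lceil 6\log K\rceil$, $T_2=\lfloor T/(3T_1)\rfloor$, $\varepsilon_0=\sqrt{2\sigma^2\log(48)/T_2}$ (if $T_2=0$, then $\varepsilon_0$ and all empirical means are set to $0$). Add deterministic arms $0$ and $K+1$ with known means $-\infty$ and $+\infty$. Consider the binary tree of nodes $\{L,M,R\}$ with $M=\lfloor (L+R)/2\rfloor$, root $L=0$, $R=K+1$; the nodes with $R=L+1$ are leaves, and any other node has the left child with outer entries $(L,M)$ and the right child with outer entries $(M,R)$. The root is its own parent. *Walk.* Start at the root. In each of $T_1$ steps, sample each of the three entries of the current node $T_2$ times, giving empirical means $\hat\mu_l,\hat\mu_m,\hat\mu_r$. If $\tau\notin[\hat\mu_l,\hat\mu_r]$, move to the parent; otherwise, stay if the node is a leaf, else move to the right child if $\hat\mu_m\le\tau\le\hat\mu_r$, else to the left child. *Selection.* Let $\hat\varepsilon=2\varepsilon_0$ if in some step the node is a leaf with $\hat\mu_l\le\tau\le\hat\mu_r$; otherwise let $\hat\varepsilon$ be the maximum of $2\varepsilon_0$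 and the smallest value of $|\hat\mu_k-\tau|$ over all steps and entries $k\in\{l,m,r\}$. In each step, an entry is a candidate if its empirical mean is within $\hat\varepsilon$ of $\tau$, and the right entry of a leaf is also a candidate if $\hat\mu_l+\hat\varepsilon<\tau\le\hat\mu_r-\hat\varepsilon$. For each step with a candidate, append one candidate arm, chosen uniformly at random, to a list. Let $\hat k$ be the (lower) median of the list; output $\widehat Q_k=1$ for $k\ge\hat k$ and $\widehat Q_k=-1$ for $k<\hat k$. **Theorem.** There is a universal constant $c>0$ such that the following holds for all integers $K\ge3$ and $T$. 1. If $0<\tau<1$ and $T\ge 12\log K$, then $$c\,\tau(1-\tau)\sqrt{\frac{\log K}{T}}\ \le\ \bar R_T^*(\mathcal B_s)\ \le\ 80\sqrt{\frac{\log K}{T}},$$ and MTB with $\sigma=1$ attains the upper bound: $\sup_{\nu\in\mathcal B_s}\bar R_T^{\nu,\mathrm{MTB}}\le 80\sqrt{\log K/T}$. In particular $\bar R_T^*(\mathcal B_s)\asymp\sqrt{\log K/T}$ for each fixed $\tau\in(0,1)$, with constants independent of $K$ and $T$. 2. For all $\sigma>0$ and $\tau\in\mathbb R$, if $T\ge 3\lceil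 6\log K\rceil$ (that is, $T_2\ge1$), then $$c\,\sqrt{\frac{\sigma^2\log K}{T}}\ \le\ \bar R_T^*(\mathcal B_s^\sigma)\ \le\ 80\sqrt{\frac{\sigma^2\log K}{T}},$$ and MTB with parameter $\sigma$ attains the upper bound: $\sup_{\nu\in\mathcal B_s^\sigma}\bar R_T^{\nu,\mathrm{MTB}}\le 80\sqrt{\sigma^2\log K/T}$. -/

import Mathlib

open MeasureTheory ProbabilityTheory
open scoped ENNReal NNReal

noncomputable section

namespace ThresholdBandit

/-! ### Bandit problems -/

/-- The mean of the distribution of an arm. -/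
def mean (P : ProbabilityMeasure ℝ) : ℝ := ∫ x, x ∂(P : Measure ℝ)

/-- Bandit problems with `K` arms, all arms supported in `[0,1]`, and means nondecreasing in the
index of the arm. Arm `k` of `1, …, K` is the element `k - 1` of `Fin K`. -/
def boundedMonotone (K : ℕ) : Set (Fin K → ProbabilityMeasure ℝ) :=
  {ν | (∀ k, ∀ᵐ x ∂(ν k : Measure ℝ), x ∈ Set.Icc (0 : ℝ) 1) ∧ Monotone fun k => mean (ν k)}

/-- Bandit problems with `K` arms, all arms `σ²`-sub-Gaussian (around their means), and means
nondecreasing in the index of the arm. -/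
def subGaussianMonotone (K : ℕ) (σ : ℝ) : Set (Fin K → ProbabilityMeasure ℝ) :=
  {ν | (∀ k, HasSubgaussianMGF (fun x => x - mean (ν k)) (⟨σ ^ 2, sq_nonneg σ⟩ : ℝ≥0)
      (ν k : Measure ℝ)) ∧ Monotone fun k => mean (ν k)}

/-! ### Strategies, interaction, regret -/

/-- A (possibly randomized) strategy with budget `T` for `K` arms. `Seed` carries the internal
randomness of the learner, drawn once from `law`, independently of the rewards. In round `t` the
arm pulled is a measurable function of the seed and of the rewards observed before (the arms pulled
before are determined by these data). After `T` rounds the learner outputs a classification of the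
arms: `true` stands for `+1` (mean at least the threshold), `false` for `-1`. -/
structure Strategy (K T : ℕ) where
  Seed : Type
  [seedSpace : MeasurableSpace Seed]
  law : Measure Seed
  [isProb : IsProbabilityMeasure law]
  pull : (t : Fin T) → Seed × (Fin t → ℝ) → Fin K
  guess : Seed × (Fin T → ℝ) → Fin K → Bool
  measurable_pull : ∀ t, Measurable (pull t)
  measurable_guess : Measurable guess

attribute [instance] Strategy.seedSpace Strategy.isProb

/-- The rewards observed in the first `t` rounds. The table `x` holds, for every round `t` and every
arm `k`, the reward `x t k` that is observed if arm `k` is pulled in round `t`. -/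
def Strategy.rewards {K T : ℕ} (π : Strategy K T) (s : π.Seed) (x : Fin T → Fin K → ℝ) :
    (t : ℕ) → t ≤ T → (Fin t → ℝ)
  | 0, _ => Fin.elim0
  | t + 1, h =>
    Fin.snoc (α := fun _ => ℝ) (π.rewards s x t (Nat.le_of_succ_le h))
      (x ⟨t, h⟩ (π.pull ⟨t, h⟩ (s, π.rewards s x t (Nat.le_of_succ_le h))))

/-- The law of the reward table: independent entries, the entry of arm `k` having law `ν k`. Thus,
given the past, the reward observed in a round is drawn from the law of the arm pulled. -/
def tableLaw {K : ℕ} (T : ℕ) (ν : Fin K → ProbabilityMeasure ℝ) : Measure (Fin T → Fin K → ℝ) :=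
  Measure.pi fun _ : Fin T => Measure.pi fun k : Fin K => (ν k : Measure ℝ)

/-- The simple regret of the classification `q`: the largest gap `|τ - μ_k|` of a misclassified
arm `k`, and `0` if there is none. -/
def regret {K : ℕ} (τ : ℝ) (ν : Fin K → ProbabilityMeasure ℝ) (q : Fin K → Bool) : ℝ≥0∞ :=
  ⨆ (k : Fin K) (_ : ¬(q k = true ↔ τ ≤ mean (ν k))), ENNReal.ofReal |τ - mean (ν k)|

/-- The expected simple regret of the strategy `π` on the problem `ν`. -/
def expRegret {K T : ℕ} (τ : ℝ) (ν : Fin K → ProbabilityMeasure ℝ) (π : Strategy K T) : ℝ≥0∞ :=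
  ∫⁻ z, regret τ ν (π.guess (z.1, π.rewards z.1 z.2 T le_rfl)) ∂(π.law.prod (tableLaw T ν))

/-- The worst expected simple regret of `π` over the class `B` of problems. -/
def worstRegret {K T : ℕ} (τ : ℝ) (B : Set (Fin K → ProbabilityMeasure ℝ)) (π : Strategy K T) :
    ℝ≥0∞ :=
  ⨆ ν ∈ B, expRegret τ ν π

/-- The minimax expected simple regret over the class `B` with budget `T`. The strategy may depend
on `K`, `T`, `τ` and `B`. -/
def minimaxRegret {K : ℕ} (T : ℕ) (τ : ℝ) (B : Set (Fin K → ProbabilityMeasure ℝ)) : ℝ≥0∞ :=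
  ⨅ π : Strategy K T, worstRegret τ B π

/-! ### The algorithm MTB -/

namespace MTB

/-- Number of steps of the walk, `⌈6 log K⌉`. -/
def T₁ (K : ℕ) : ℕ := ⌈6 * Real.log K⌉₊

/-- Number of samples per step and per entry of the current node, `⌊T / (3 T₁)⌋`. -/
def T₂ (K T : ℕ) : ℕ := T / (3 * T₁ K)

/-- The tolerance `ε₀ = √(2 σ² log 48 / T₂)`. -/
def eps0 (K T : ℕ) (σ : ℝ) : ℝ := √(2 * σ ^ 2 * Real.log 48 / T₂ K T)

/-- A node of the binary tree is given by the moves that lead to it from the root, the last move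
first; `true` is a move to the right child. The parent of a node is its `List.tail` (the root is its
own parent). `ends K p` are the outer entries `L`, `R` of the node `p`. The tree is built on the
arms `1, …, K` and two deterministic arms `0` and `K + 1`, with means `-∞` and `+∞`. -/
def ends (K : ℕ) : List Bool → ℕ × ℕ
  | [] => (0, K + 1)
  | b :: p =>
    let e := ends K p
    if b then ((e.1 + e.2) / 2, e.2) else (e.1, (e.1 + e.2) / 2)

/-- The three entries `L`, `M`, `R` of a node. -/
def entry (K : ℕ) (p : List Bool) : Fin 3 → ℕ :=
  ![(ends K p).1, ((ends K p).1 + (ends K p).2) / 2, (ends K p).2]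

/-- Leaves are the nodes with `R = L + 1`. -/
def IsLeaf (K : ℕ) (p : List Bool) : Prop := (ends K p).2 = (ends K p).1 + 1

/-- The average of the rewards, in the sequence `y` of all rewards, that belong to step `i` and
slot `j`: step `i` consists of `3 T₂` rounds, the first `T₂` of them for the left entry of the
current node, the next for the middle entry, the last for the right entry. -/
def average (K T : ℕ) (y : ℕ → ℝ) (i : ℕ) (j : Fin 3) : ℝ :=
  (∑ s ∈ Finset.range (T₂ K T), y (i * (3 * T₂ K T) + j * T₂ K T + s)) / T₂ K T

/-- The estimate, in step `i`, of the mean of entry `j` of the node `p`. The means of the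
deterministic arms `0` and `K + 1` are known. -/
def est (K T : ℕ) (y : ℕ → ℝ) (i : ℕ) (p : List Bool) (j : Fin 3) : EReal :=
  if entry K p j = 0 then ⊥ else if entry K p j = K + 1 then ⊤ else (average K T y i j : EReal)

open Classical in
/-- One step of the walk from the node `p`, given the estimates `m` for its three entries. -/
def step (K : ℕ) (τ : ℝ) (p : List Bool) (m : Fin 3 → EReal) : List Bool :=
  if ¬(m 0 ≤ τ ∧ (τ : EReal) ≤ m 2) then p.tail
  else if IsLeaf K p then p
  else if m 1 ≤ τ ∧ (τ : EReal) ≤ m 2 then true :: p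
  else false :: p

/-- The node visited in step `i` (steps are numbered from `0`). -/
def node (K T : ℕ) (τ : ℝ) (y : ℕ → ℝ) : ℕ → List Bool
  | 0 => []
  | i + 1 => step K τ (node K T τ y i) (est K T y i (node K T τ y i))

/-- The estimates at the node visited in step `i`. -/
def nodeEst (K T : ℕ) (τ : ℝ) (y : ℕ → ℝ) (i : ℕ) : Fin 3 → EReal :=
  est K T y i (node K T τ y i)

/-- In step `i` the walk is at a leaf whose estimates enclose the threshold. -/
def Encloses (K T : ℕ) (τ : ℝ) (y : ℕ → ℝ) (i : ℕ) : Prop :=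
  IsLeaf K (node K T τ y i) ∧ nodeEst K T τ y i 0 ≤ τ ∧ (τ : EReal) ≤ nodeEst K T τ y i 2

open Classical in
/-- The parameter with which the second phase is run: `2 ε₀` if some visited leaf encloses the
threshold, else the maximum of `2 ε₀` and the least distance of an estimate from the threshold. -/
def epsHat (K T : ℕ) (τ σ : ℝ) (y : ℕ → ℝ) : ℝ :=
  if ∃ i : Fin (T₁ K), Encloses K T τ y i then 2 * eps0 K T σ
  else max (2 * eps0 K T σ)
    (⨅ (i : Fin (T₁ K)) (j : Fin 3), (nodeEst K T τ y i j - (τ : EReal)).abs).toReal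

/-- Entry `j` of the node visited in step `i` is a candidate for the parameter `ε`: its estimate is
within `ε` of the threshold, or the node is a leaf, `j` is its right entry, and
`μ̂_l + ε < τ ≤ μ̂_r - ε`. -/
def IsCandidate (K T : ℕ) (τ : ℝ) (y : ℕ → ℝ) (ε : ℝ) (i : ℕ) (j : Fin 3) : Prop :=
  (((τ - ε : ℝ) : EReal) ≤ nodeEst K T τ y i j ∧ nodeEst K T τ y i j ≤ ((τ + ε : ℝ) : EReal)) ∨
  (j = 2 ∧ IsLeaf K (node K T τ y i) ∧ nodeEst K T τ y i 0 < ((τ - ε : ℝ) : EReal) ∧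
    ((τ + ε : ℝ) : EReal) ≤ nodeEst K T τ y i 2)

/-- The internal randomness: for each step, an ordering of the three entries of a node. -/
abbrev Seed (K : ℕ) : Type := Fin (T₁ K) → Equiv.Perm (Fin 3)

instance (K : ℕ) : MeasurableSpace (Seed K) := ⊤

instance (K : ℕ) : Nonempty (Seed K) := ⟨fun _ => 1⟩

open Classical in
/-- The arm appended to the list in step `i`, if any: the first candidate in the order given by the
seed. For a uniform random ordering it is uniformly distributed among the candidates. -/
def selected (K T : ℕ) (τ σ : ℝ) (s : Seed K) (y : ℕ → ℝ) (i : Fin (T₁ K)) : Option ℕ :=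
  let c := IsCandidate K T τ y (epsHat K T τ σ y) i
  if c (s i 0) then some (entry K (node K T τ y i) (s i 0))
  else if c (s i 1) then some (entry K (node K T τ y i) (s i 1))
  else if c (s i 2) then some (entry K (node K T τ y i) (s i 2))
  else none

/-- The median of a list of natural numbers (the lower one for a list of even length). -/
def median (l : List ℕ) : ℕ :=
  (l.mergeSort (fun a b => decide (a ≤ b))).getD ((l.length - 1) / 2) 0

/-- The arm returned by the second phase, an element of `{1, …, K + 1}`. -/
def chosen (K T : ℕ) (τ σ : ℝ) (s : Seed K) (y : ℕ → ℝ) : ℕ :=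
  median ((List.finRange (T₁ K)).filterMap (selected K T τ σ s y))

/-- A finite sequence of rewards, continued by zeros. -/
def extend {t : ℕ} (h : Fin t → ℝ) (n : ℕ) : ℝ := if hn : n < t then h ⟨n, hn⟩ else 0

/-- The element of `Fin K` that stands for arm `a ∈ {1, …, K}`. If the deterministic arm `0` or
`K + 1` has to be sampled, an arbitrary arm is pulled and its reward is ignored. -/
def toArm (K : ℕ) (hK : 0 < K) (a : ℕ) : Fin K :=
  if h : a - 1 < K then ⟨a - 1, h⟩ else ⟨0, hK⟩

/-- The arm pulled in round `t` (rounds are numbered from `0`). The rounds after the `3 T₁ T₂`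
rounds of the walk are irrelevant. -/
def pull (K T : ℕ) (hK : 0 < K) (τ : ℝ) (t : ℕ) (h : Fin t → ℝ) : Fin K :=
  toArm K hK (entry K (node K T τ (extend h) (t / (3 * T₂ K T)))
    (Fin.ofNat 3 (t % (3 * T₂ K T) / T₂ K T)))

/-- The classification returned: `+1` from the chosen arm on, `-1` before. -/
def guess (K T : ℕ) (τ σ : ℝ) (z : Seed K × (Fin T → ℝ)) (k : Fin K) : Bool :=
  decide (chosen K T τ σ z.1 (extend z.2) ≤ k + 1)

/-! Measurability of the algorithm. -/

instance : MeasurableSpace (List Bool) := ⊤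
instance : DiscreteMeasurableSpace (List Bool) := ⟨fun _ => trivial⟩
instance : MeasurableSpace (List ℕ) := ⊤
instance : DiscreteMeasurableSpace (List ℕ) := ⟨fun _ => trivial⟩
instance : MeasurableSpace (Option ℕ) := ⊤
instance : DiscreteMeasurableSpace (Option ℕ) := ⟨fun _ => trivial⟩
instance (K : ℕ) : DiscreteMeasurableSpace (Seed K) := ⟨fun _ => trivial⟩

lemma measurable_extend (t : ℕ) : Measurable (fun h : Fin t → ℝ => extend h) := by
  refine measurable_pi_lambda _ fun n => ?_
  unfold extend
  split_ifs
  · exact measurable_pi_apply _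
  · exact measurable_const

lemma measurable_average (K T i : ℕ) (j : Fin 3) : Measurable fun y => average K T y i j := by
  unfold average
  fun_prop

lemma measurable_est (K T i : ℕ) (p : List Bool) (j : Fin 3) :
    Measurable fun y => est K T y i p j := by
  unfold est
  split_ifs
  · exact measurable_const
  · exact measurable_const
  · exact (measurable_average K T i j).coe_real_ereal

lemma measurable_step (K : ℕ) (τ : ℝ) (p : List Bool) : Measurable (step K τ p) := by
  unfold step
  refine Measurable.ite ?_ measurable_const (Measurable.ite (MeasurableSet.const _)
    measurable_const (Measurable.ite ?_ measurable_const measurable_const))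
  · exact ((measurableSet_le (measurable_pi_apply _) measurable_const).inter
      (measurableSet_le measurable_const (measurable_pi_apply _))).compl
  · exact (measurableSet_le (measurable_pi_apply _) measurable_const).inter
      (measurableSet_le measurable_const (measurable_pi_apply _))

/-- A quantity that depends on the node visited and on the rewards is measurable if it is so for
each node. -/
lemma measurable_at_node {α : Type*} [MeasurableSpace α] {K T : ℕ} {τ : ℝ} {i : ℕ}
    (hn : Measurable fun y => node K T τ y i) {f : List Bool → (ℕ → ℝ) → α}
    (hf : ∀ p, Measurable (f p)) : Measurable fun y => f (node K T τ y i) y :=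
  (measurable_from_prod_countable_right (f := fun z : List Bool × (ℕ → ℝ) => f z.1 z.2) hf).comp
    (hn.prodMk measurable_id)

lemma measurable_node (K T : ℕ) (τ : ℝ) (i : ℕ) : Measurable fun y => node K T τ y i := by
  induction i with
  | zero => exact measurable_const
  | succ i ih =>
    exact measurable_at_node (f := fun p y => step K τ p (est K T y i p)) ih fun p =>
      (measurable_step K τ p).comp (measurable_pi_lambda _ fun j => measurable_est K T i p j)

lemma measurable_nodeEst (K T : ℕ) (τ : ℝ) (i : ℕ) (j : Fin 3) :
    Measurable fun y => nodeEst K T τ y i j :=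
  measurable_at_node (f := fun p y => est K T y i p j) (measurable_node K T τ i) fun p =>
    measurable_est K T i p j

lemma measurableSet_isLeaf (K T : ℕ) (τ : ℝ) (i : ℕ) :
    MeasurableSet {y | IsLeaf K (node K T τ y i)} :=
  measurable_node K T τ i (MeasurableSet.of_discrete (s := {p | IsLeaf K p}))

lemma measurableSet_encloses (K T : ℕ) (τ : ℝ) (i : ℕ) :
    MeasurableSet {y | Encloses K T τ y i} :=
  (measurableSet_isLeaf K T τ i).inter
    ((measurableSet_le (measurable_nodeEst K T τ i 0) measurable_const).inter
      (measurableSet_le measurable_const (measurable_nodeEst K T τ i 2)))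

lemma measurable_dist (K T : ℕ) (τ : ℝ) (i : ℕ) (j : Fin 3) :
    Measurable fun y => (nodeEst K T τ y i j - (τ : EReal)).abs := by
  have h : Measurable fun m : EReal => (m - (τ : EReal)).abs := by
    apply EReal.measurable_of_measurable_real
    have : ∀ x : ℝ, ((x : EReal) - (τ : EReal)).abs = ENNReal.ofReal |x - τ| := fun x => by
      rw [← EReal.coe_sub, EReal.abs_def]
    simp only [this]
    exact ((measurable_id.sub_const τ).abs).ennreal_ofReal
  exact h.comp (measurable_nodeEst K T τ i j)

lemma measurable_epsHat (K T : ℕ) (τ σ : ℝ) : Measurable fun y => epsHat K T τ σ y := by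
  unfold epsHat
  refine Measurable.ite ?_ measurable_const (measurable_const.max
    (Measurable.ennreal_toReal (Measurable.iInf fun i => Measurable.iInf fun j =>
      measurable_dist K T τ i j)))
  have : {y | ∃ i : Fin (T₁ K), Encloses K T τ y i} = ⋃ i : Fin (T₁ K), {y | Encloses K T τ y i} := by
    ext; simp
  rw [this]
  exact MeasurableSet.iUnion fun i => measurableSet_encloses K T τ i

lemma measurableSet_isCandidate (K T : ℕ) (τ σ : ℝ) (i : ℕ) (j : Fin 3) :
    MeasurableSet {y | IsCandidate K T τ y (epsHat K T τ σ y) i j} := by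
  have hm := measurable_nodeEst K T τ i
  have hlo := (measurable_const (a := τ)).sub (measurable_epsHat K T τ σ) |>.coe_real_ereal
  have hhi := (measurable_const (a := τ)).add (measurable_epsHat K T τ σ) |>.coe_real_ereal
  exact ((measurableSet_le hlo (hm j)).inter (measurableSet_le (hm j) hhi)).union
    ((MeasurableSet.const _).inter ((measurableSet_isLeaf K T τ i).inter
      ((measurableSet_lt (hm 0) hlo).inter (measurableSet_le hhi (hm 2)))))

lemma measurable_selected (K T : ℕ) (τ σ : ℝ) (s : Seed K) (i : Fin (T₁ K)) :
    Measurable fun y => selected K T τ σ s y i := by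
  have hc := measurableSet_isCandidate K T τ σ i
  have he : ∀ j, Measurable fun y => some (entry K (node K T τ y i) j) := fun j =>
    (Measurable.of_discrete (f := fun p => some (entry K p j))).comp (measurable_node K T τ i)
  exact Measurable.ite (hc _) (he _) (Measurable.ite (hc _) (he _)
    (Measurable.ite (hc _) (he _) measurable_const))

lemma measurable_filterMap {α ι : Type*} [MeasurableSpace α] (f : ι → α → Option ℕ)
    (hf : ∀ i, Measurable (f i)) (l : List ι) :
    Measurable fun a => l.filterMap fun i => f i a := by
  induction l with
  | nil => exact measurable_const
  | cons i l ih =>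
    have : (fun a => (i :: l).filterMap fun i => f i a) = fun a =>
        (fun q : Option ℕ × List ℕ => q.1.elim q.2 (· :: q.2))
          (f i a, l.filterMap fun i => f i a) := by
      funext a
      cases h : f i a <;> simp [h]
    rw [this]
    exact (Measurable.of_discrete
      (f := fun q : Option ℕ × List ℕ => q.1.elim q.2 (· :: q.2))).comp ((hf i).prodMk ih)

lemma measurable_chosen (K T : ℕ) (τ σ : ℝ) (s : Seed K) :
    Measurable fun y => chosen K T τ σ s y :=
  (Measurable.of_discrete (f := median)).comp
    (measurable_filterMap (fun i y => selected K T τ σ s y i)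
      (fun i => measurable_selected K T τ σ s i) _)

lemma measurable_guess (K T : ℕ) (τ σ : ℝ) : Measurable (guess K T τ σ) := by
  refine measurable_from_prod_countable_right fun s => measurable_pi_lambda _ fun k => ?_
  change Measurable fun h : Fin T → ℝ => decide (chosen K T τ σ s (extend h) ≤ (k : ℕ) + 1)
  exact (Measurable.of_discrete (f := fun n : ℕ => decide (n ≤ (k : ℕ) + 1))).comp
    ((measurable_chosen K T τ σ s).comp (measurable_extend T))

lemma measurable_pull (K T : ℕ) (hK : 0 < K) (τ : ℝ) (t : ℕ) : Measurable (pull K T hK τ t) :=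
  (Measurable.of_discrete (f := fun p => toArm K hK (entry K p
    (Fin.ofNat 3 (t % (3 * T₂ K T) / T₂ K T))))).comp
    ((measurable_node K T τ _).comp (measurable_extend t))

end MTB

/-- The strategy MTB, with parameter `σ` in the tolerance `ε₀`, and ties broken uniformly at
random. -/
def mtb (K T : ℕ) (hK : 0 < K) (τ σ : ℝ) : Strategy K T where
  Seed := MTB.Seed K
  law := (PMF.uniformOfFintype (MTB.Seed K)).toMeasure
  pull t z := MTB.pull K T hK τ t z.2
  guess := MTB.guess K T τ σ
  measurable_pull t := (MTB.measurable_pull K T hK τ t).comp measurable_snd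
  measurable_guess := MTB.measurable_guess K T τ σ

end ThresholdBandit

end

/-! Upper bound. Let κ be the first arm with mean at least τ, or K + 1 if there is none. Away from
enclosing leaves, a step whose three estimates lie on the correct side of τ brings the walk one edge
closer to the leaf (κ - 1, κ); any other step costs at most one edge. The depth D ≤ log₂ K + 1 is at
most T₁ / 2, so such correct steps cannot be much more than half of all steps (`two_mul_card_le`).
An accurate step outside this class is at an enclosing leaf or has an estimate near τ; then it has a
candidate, and its candidates are acceptable cuts. By monotonicity of the means, acceptable cuts
form an interval, so a majority in the list puts the median into it. Thus the regret is at most 4 ε₀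
unless a fixed fraction of the steps deviate by more than 2 ε₀ (`chosen_acceptable`).

In that bad case the regret is still at most twice the largest deviation e
(`chosen_acceptable_of_forall`). To control its expectation, each step gets an exponential `weight`,
at least 1, whose mean is at most 11/10 at any fixed node. In the bad case the product of the
weights is at least 2 ^ T₁ * e / (2 ε₀) (`pow_le_prod_weight`). Hence the regret is always at most 4
ε₀ (1 + 2 ^ (-T₁) * product), with mean at most 4.4 ε₀. Rewards in [0,1] are covered by Hoeffding's
lemma.

Lower bound. In the k-th of K problems, all arms have two-point laws, with mean τ + Δ from arm k on
and τ - Δ before. Compare with the problem in which all means are τ: the likelihood ratio has second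
moment at most K / 2 after T adaptive pulls. The events "the output is exactly right for problem k"
are disjoint, so their probabilities, each under its own problem, average to at most 3/4
(`sum_lintegral_indicator_le`). Every failure costs Δ. -/

namespace ThresholdBandit.MTB

/-! ### The tree -/

/-- The nodes of the tree: a node is the root or the child of a node that is not a leaf. -/
def IsNode (K : ℕ) : List Bool → Prop
  | [] => True
  | _ :: p => ¬IsLeaf K p ∧ IsNode K p

/-- The outer entries of the node `p` enclose the boundary between the arms `κ - 1` and `κ`. -/
def Contains (K κ : ℕ) (p : List Bool) : Prop := (ends K p).1 < κ ∧ κ ≤ (ends K p).2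

open Classical in
/-- The signed distance from the root to the node `p`: moves towards the leaf `(κ - 1, κ)` count
negatively. -/
noncomputable def potential (K κ : ℕ) : List Bool → ℤ
  | [] => 0
  | b :: p => potential K κ p + if Contains K κ (b :: p) then -1 else 1

lemma IsNode.tail {K : ℕ} {p : List Bool} (h : IsNode K p) : IsNode K p.tail := by
  cases p with
  | nil => exact h
  | cons b p => exact h.2

lemma IsNode.ends_lt {K : ℕ} {p : List Bool} (h : IsNode K p) : (ends K p).1 < (ends K p).2 := by
  induction p with
  | nil => simp [ends]
  | cons b p ih =>
    have h1 := ih h.2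
    have h2 := h.1
    unfold IsLeaf at h2
    cases b <;> simp only [ends, if_true, if_false, Bool.false_eq_true] <;> omega

lemma IsNode.ends_le {K : ℕ} {p : List Bool} (h : IsNode K p) : (ends K p).2 ≤ K + 1 := by
  induction p with
  | nil => simp [ends]
  | cons b p ih =>
    have h1 := ih h.2
    have h2 := h.2.ends_lt
    cases b <;> simp only [ends, if_true, if_false, Bool.false_eq_true] <;> omega

/-- Each move at least halves the number of arms strictly between the outer entries: a node of width
n has children of width at most ⌈n/2⌉, and 2 (⌈n/2⌉ - 1) ≤ n - 1. The root has K such arms. -/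
lemma IsNode.pow_mul_width_le {K : ℕ} {p : List Bool} (h : IsNode K p) :
    2 ^ p.length * ((ends K p).2 - (ends K p).1 - 1) ≤ K := by
  induction p with
  | nil => simp [ends]
  | cons b p ih =>
    refine le_trans ?_ (ih h.2)
    rw [List.length_cons, pow_succ, mul_assoc]
    refine Nat.mul_le_mul_left _ ?_
    have h1 := h.2.ends_lt
    cases b <;> simp only [ends, if_true, if_false, Bool.false_eq_true] <;> omega

/-- The parent is not a leaf, so it has an arm strictly inside, and halving bounds its depth by log₂
K. -/
lemma IsNode.length_le {K : ℕ} {p : List Bool} (h : IsNode K p) :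
    p.length ≤ Nat.log 2 K + 1 := by
  cases p with
  | nil => simp
  | cons b p =>
    have h1 := h.2.pow_mul_width_le
    have h2 := h.1
    have h3 := h.2.ends_lt
    unfold IsLeaf at h2
    have h4 : 1 ≤ (ends K p).2 - (ends K p).1 - 1 := by omega
    have h5 : 2 ^ p.length ≤ K := le_trans (Nat.le_mul_of_pos_right _ h4) h1
    have h6 := Nat.le_log_of_pow_le (b := 2) (by norm_num) h5
    simpa using h6

lemma IsNode.entry_le {K : ℕ} {p : List Bool} (h : IsNode K p) (j : Fin 3) :
    entry K p j ≤ K + 1 := by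
  have h1 := h.ends_lt
  have h2 := h.ends_le
  fin_cases j <;> simp [entry] <;> omega

lemma IsNode.step {K : ℕ} {p : List Bool} (h : IsNode K p) (τ : ℝ) (m : Fin 3 → EReal) :
    IsNode K (step K τ p m) := by
  unfold MTB.step
  split_ifs with h1 h2 h3
  · exact h
  · exact ⟨h2, h⟩
  · exact ⟨h2, h⟩
  · exact h.tail

lemma isNode_node (K T : ℕ) (τ : ℝ) (y : ℕ → ℝ) (i : ℕ) : IsNode K (node K T τ y i) := by
  induction i with
  | zero => trivial
  | succ i ih => exact ih.step τ _

/-- Hence once a path has left the nodes around κ, it never meets them again further down, and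
`potential` is a signed distance. -/
lemma Contains.of_cons {K κ : ℕ} {b : Bool} {p : List Bool} (hp : IsNode K p)
    (h : Contains K κ (b :: p)) : Contains K κ p := by
  have h1 := hp.ends_lt
  unfold Contains at *
  cases b <;> simp only [ends, if_true, if_false, Bool.false_eq_true] at h <;> omega

lemma Contains.potential_eq {K κ : ℕ} {p : List Bool} (hp : IsNode K p) (h : Contains K κ p) :
    potential K κ p = -p.length := by
  induction p with
  | nil => simp [potential]
  | cons b p ih =>
    rw [potential, if_pos h, ih hp.2 (h.of_cons hp.2)]
    push_cast [List.length_cons]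
    ring

lemma IsNode.neg_le_potential {K κ : ℕ} {p : List Bool} (hp : IsNode K p) :
    -((Nat.log 2 K + 1 : ℕ) : ℤ) ≤ potential K κ p := by
  induction p with
  | nil => simp only [potential]; omega
  | cons b p ih =>
    by_cases h : Contains K κ (b :: p)
    · rw [h.potential_eq hp]
      have := hp.length_le
      omega
    · rw [potential, if_neg h]
      have := ih hp.2
      omega

lemma potential_step_le (K κ : ℕ) (τ : ℝ) (p : List Bool) (m : Fin 3 → EReal) :
    potential K κ (step K τ p m) ≤ potential K κ p + 1 := by
  unfold step
  split_ifs with h1 h2 h3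
  · omega
  · simp only [potential]; split_ifs <;> omega
  · simp only [potential]; split_ifs <;> omega
  · cases p with
    | nil => simp [potential]
    | cons b p => simp only [List.tail_cons, potential]; split_ifs <;> omega

/-- Correctly placed estimates tell whether κ lies in the node and in which half: inside, the walk
descends towards κ; outside, it undoes a wrong move. Enclosing leaves are excluded because the walk
stays there. -/
lemma potential_step_of_correct {K κ : ℕ} (hκ : 1 ≤ κ) (hκK : κ ≤ K + 1) {τ : ℝ} {p : List Bool}
    {m : Fin 3 → EReal} (hm : ∀ j, (m j ≤ τ ↔ entry K p j < κ) ∧ ((τ : EReal) ≤ m j ↔ κ ≤ entry K p j))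
    (hne : ¬(IsLeaf K p ∧ m 0 ≤ τ ∧ (τ : EReal) ≤ m 2)) :
    potential K κ (step K τ p m) = potential K κ p - 1 := by
  have e0 : entry K p 0 = (ends K p).1 := rfl
  have e1 : entry K p 1 = ((ends K p).1 + (ends K p).2) / 2 := rfl
  have e2 : entry K p 2 = (ends K p).2 := rfl
  have hc : (m 0 ≤ τ ∧ (τ : EReal) ≤ m 2) ↔ Contains K κ p := by
    rw [(hm 0).1, (hm 2).2, e0, e2, Contains]
  unfold step
  split_ifs with h1 h2 h3
  · exact absurd ⟨h2, h1⟩ hne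
  · rw [potential, if_pos]
    · ring
    · rw [(hm 1).1, (hm 2).2, e1, e2] at h3
      simpa [Contains, ends] using h3
  · rw [potential, if_pos]
    · ring
    · have h4 := hc.1 h1
      have h5 : κ ≤ ((ends K p).1 + (ends K p).2) / 2 := by
        rw [← e1, ← not_lt, ← (hm 1).1]
        exact fun h => h3 ⟨h, h1.2⟩
      exact ⟨by simpa [ends] using h4.1, by simpa [ends] using h5⟩
  · rw [hc] at h1
    cases p with
    -- The root encloses every κ in 1, …, K + 1, so correct estimates never ask for its parent.
    | nil => exact absurd (by simpa [Contains, ends] using ⟨by omega, hκK⟩) h1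
    | cons b p => rw [potential, if_neg h1]; simp

/-- All three estimates of step `i` are on the correct side of the threshold. -/
def Correct (K T : ℕ) (τ : ℝ) (y : ℕ → ℝ) (κ i : ℕ) : Prop :=
  ∀ j, (nodeEst K T τ y i j ≤ τ ↔ entry K (node K T τ y i) j < κ) ∧
    ((τ : EReal) ≤ nodeEst K T τ y i j ↔ κ ≤ entry K (node K T τ y i) j)

open Classical in
-- The step bounds telescope: -1 for steps in `S`, at most +1 for the others.
lemma potential_node_le {K κ : ℕ} (hκ : 1 ≤ κ) (hκK : κ ≤ K + 1) (T : ℕ) (τ : ℝ) (y : ℕ → ℝ)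
    (n : ℕ) (S : Finset ℕ) (hS : ∀ i ∈ S, Correct K T τ y κ i ∧ ¬Encloses K T τ y i) :
    potential K κ (node K T τ y n) ≤ n - 2 * ((S.filter (· < n)).card : ℤ) := by
  induction n with
  | zero => simp [node, potential]
  | succ n ih =>
    by_cases hn : n ∈ S
    · have h1 : S.filter (· < n + 1) = insert n (S.filter (· < n)) := by
        ext a
        simp only [Finset.mem_filter, Finset.mem_insert]
        constructor
        · rintro ⟨h, h'⟩
          rcases Nat.lt_succ_iff_lt_or_eq.1 h' with h'' | h''
          · exact Or.inr ⟨h, h''⟩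
          · exact Or.inl h''
        · rintro (rfl | ⟨h, h'⟩)
          · exact ⟨hn, by omega⟩
          · exact ⟨h, by omega⟩
      have h2 := potential_step_of_correct hκ hκK (hS n hn).1 (hS n hn).2
      unfold nodeEst at h2
      rw [h1, Finset.card_insert_of_notMem (by simp), node, h2]
      push_cast
      linarith
    · have h1 : S.filter (· < n + 1) = S.filter (· < n) := by
        ext a
        simp only [Finset.mem_filter]
        constructor
        · rintro ⟨h, h'⟩
          have : a ≠ n := fun e => hn (e ▸ h)
          exact ⟨h, by omega⟩
        · rintro ⟨h, h'⟩
          exact ⟨h, by omega⟩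
      rw [h1, node]
      have := potential_step_le K κ τ (node K T τ y n) (est K T y n (node K T τ y n))
      push_cast
      linarith

/-- The number of correct steps at which the walk is not at an enclosing leaf exceeds the number of
the other steps by at most the depth of the tree. -/
lemma two_mul_card_le {K κ : ℕ} (hκ : 1 ≤ κ) (hκK : κ ≤ K + 1) (T : ℕ) (τ : ℝ) (y : ℕ → ℝ)
    (n : ℕ) (S : Finset (Fin n))
    (hS : ∀ i ∈ S, Correct K T τ y κ i ∧ ¬Encloses K T τ y i) :
    2 * S.card ≤ n + (Nat.log 2 K + 1) := by
  classical
  have h1 := potential_node_le hκ hκK T τ y n (S.map Fin.valEmbedding) (by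
    intro i hi
    obtain ⟨a, ha, rfl⟩ := Finset.mem_map.1 hi
    exact hS a ha)
  have h2 := (isNode_node K T τ y n).neg_le_potential (κ := κ)
  have h3 : (S.map Fin.valEmbedding).filter (· < n) = S.map Fin.valEmbedding := by
    refine Finset.filter_true_of_mem fun i hi => ?_
    obtain ⟨a, _, rfl⟩ := Finset.mem_map.1 hi
    exact a.2
  rw [h3, Finset.card_map] at h1
  omega

/-! ### The median -/

/-- If the median failed `P`, convexity would put all elements with `P` on one side of it in the
sorted list, and at most half of the list lies there. -/
lemma median_mem_of_countP {P : ℕ → Prop} [DecidablePred P]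
    (hP : ∀ a b c, a ≤ b → b ≤ c → P a → P c → P b) {l : List ℕ}
    (hl : l.length < 2 * l.countP (fun a => decide (P a))) : P (median l) := by
  set l' := l.mergeSort (fun a b => decide (a ≤ b)) with hl'
  have hperm : l'.Perm l := List.mergeSort_perm _ _
  have hlen : l'.length = l.length := hperm.length_eq
  have hcount := hperm.countP_eq (fun a => decide (P a))
  have hsort : l'.Pairwise (· ≤ ·) := by
    have := List.pairwise_mergeSort (le := fun a b : ℕ => decide (a ≤ b))
      (fun a b c => by simpa using le_trans) (fun a b => by simpa using le_total a b) l
    simpa using this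
  set m := (l.length - 1) / 2 with hm
  have hpos : 0 < l.length := by
    by_contra h
    have h0 : l = [] := by simpa using h
    simp [h0] at hl
  have hml : m < l'.length := by omega
  have hmed : median l = l'[m] := by
    rw [median, ← hl', ← hm, List.getD_eq_getElem _ _ hml]
  rw [hmed]
  by_contra hv
  have hsplit : l'.countP (fun a => decide (P a)) =
      (l'.take m).countP (fun a => decide (P a)) + (l'.drop m).countP (fun a => decide (P a)) := by
    rw [← List.countP_append, List.take_append_drop]
  have hdrop : l'.drop m = l'[m] :: l'.drop (m + 1) := List.drop_eq_getElem_cons hml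
  have hsplit2 : (l'.drop m).countP (fun a => decide (P a)) =
      (l'.drop (m + 1)).countP (fun a => decide (P a)) := by
    rw [hdrop, List.countP_cons_of_neg (by simpa using hv)]
  have hrel := List.pairwise_iff_getElem.1 hsort
  by_cases hleft : ∃ a ∈ l'.take m, P a
  · have hright : (l'.drop (m + 1)).countP (fun a => decide (P a)) = 0 := by
      rw [List.countP_eq_zero]
      intro c hc
      simp only [decide_eq_true_eq]
      intro hPc
      obtain ⟨a, ha, hPa⟩ := hleft
      obtain ⟨i, hi, rfl⟩ := List.mem_take_iff_getElem.1 ha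
      obtain ⟨j, hj, rfl⟩ := List.mem_drop_iff_getElem.1 hc
      exact hv (hP _ _ _ (hrel i m _ _ (by omega)) (hrel m _ _ _ (by omega)) hPa hPc)
    have := List.countP_le_length (p := fun a => decide (P a)) (l := l'.take m)
    have := List.length_take_le m l'
    omega
  · have h0 : (l'.take m).countP (fun a => decide (P a)) = 0 := by
      rw [List.countP_eq_zero]
      intro a ha
      simp only [decide_eq_true_eq]
      exact fun h => hleft ⟨a, ha, h⟩
    have := List.countP_le_length (p := fun a => decide (P a)) (l := l'.drop (m + 1))
    rw [List.length_drop] at this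
    omega

end ThresholdBandit.MTB

namespace ThresholdBandit.MTB

/-! ### Consequences of accurate estimates -/

/-- The deviation, in step `i`, of the estimate for entry `j` of the node `p` from the mean of that
arm, the arm `a` having mean `μ a`. It vanishes for the deterministic arms. -/
noncomputable def dev (K T : ℕ) (μ : ℕ → ℝ) (y : ℕ → ℝ) (i : ℕ) (p : List Bool) (j : Fin 3) : ℝ :=
  if entry K p j = 0 ∨ entry K p j = K + 1 then 0 else average K T y i j - μ (entry K p j)

/-- All estimates of step `i` are accurate up to `e`. -/
def Accurate (K T : ℕ) (τ : ℝ) (μ : ℕ → ℝ) (y : ℕ → ℝ) (e : ℝ) (i : ℕ) : Prop :=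
  ∀ j, |dev K T μ y i (node K T τ y i) j| ≤ e

/-- The boundary between the arms `a - 1` and `a` lies at most `r` away from the threshold. -/
def Acceptable (K : ℕ) (μ : ℕ → ℝ) (τ r : ℝ) (a : ℕ) : Prop :=
  1 ≤ a ∧ a ≤ K + 1 ∧ (a ≤ K → τ - r ≤ μ a) ∧ (2 ≤ a → μ (a - 1) ≤ τ + r)

/-- The lower constraint passes on from the left end, the upper one from the right end. This is the
convexity needed for the median. -/
lemma Acceptable.of_mem_Icc {K : ℕ} {μ : ℕ → ℝ} (hμ : ∀ a b, 1 ≤ a → a ≤ b → b ≤ K → μ a ≤ μ b)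
    {τ r : ℝ} {a b c : ℕ} (hab : a ≤ b) (hbc : b ≤ c)
    (ha : Acceptable K μ τ r a) (hc : Acceptable K μ τ r c) : Acceptable K μ τ r b := by
  obtain ⟨ha1, _, ha2, _⟩ := ha
  obtain ⟨_, hcK, _, hc2⟩ := hc
  refine ⟨ha1.trans hab, hbc.trans hcK, fun h => ?_, fun h => ?_⟩
  · exact (ha2 (hab.trans h)).trans (hμ a b ha1 hab h)
  · exact (hμ (b - 1) (c - 1) (by omega) (by omega) (by omega)).trans (hc2 (by omega))

lemma exists_boundary (K : ℕ) (μ : ℕ → ℝ) (hμ : ∀ a b, 1 ≤ a → a ≤ b → b ≤ K → μ a ≤ μ b) (τ : ℝ) :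
    ∃ κ, 1 ≤ κ ∧ κ ≤ K + 1 ∧ ∀ a, 1 ≤ a → a ≤ K → (a < κ ↔ μ a < τ) := by
  classical
  have hex : ∃ a, 1 ≤ a ∧ (a = K + 1 ∨ τ ≤ μ a) := ⟨K + 1, by omega, Or.inl rfl⟩
  refine ⟨Nat.find hex, (Nat.find_spec hex).1, Nat.find_min' hex ⟨by omega, Or.inl rfl⟩, ?_⟩
  intro a h1 h2
  constructor
  · intro h
    by_contra h'
    exact Nat.find_min hex h ⟨h1, Or.inr (not_lt.1 h')⟩
  · intro h
    by_contra h'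
    rcases (Nat.find_spec hex).2 with h3 | h3
    · omega
    · exact absurd (h3.trans (hμ _ a (Nat.find_spec hex).1 (not_lt.1 h') h2)) (not_le.2 h)

section

variable {K T : ℕ} {τ : ℝ} {μ : ℕ → ℝ} {y : ℕ → ℝ} {i : ℕ} {e ε : ℝ}

lemma nodeEst_cases (K T : ℕ) (τ : ℝ) (μ y : ℕ → ℝ) (i : ℕ) (j : Fin 3) :
    (entry K (node K T τ y i) j = 0 ∧ nodeEst K T τ y i j = ⊥) ∨
    (entry K (node K T τ y i) j = K + 1 ∧ nodeEst K T τ y i j = ⊤) ∨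
    (1 ≤ entry K (node K T τ y i) j ∧ entry K (node K T τ y i) j ≤ K ∧
      nodeEst K T τ y i j =
        ((μ (entry K (node K T τ y i) j) + dev K T μ y i (node K T τ y i) j : ℝ) : EReal)) := by
  have h := (isNode_node K T τ y i).entry_le j
  unfold nodeEst est dev
  by_cases h0 : entry K (node K T τ y i) j = 0
  · left; simp [h0]
  by_cases h1 : entry K (node K T τ y i) j = K + 1
  · right; left; simp [h1]
  right; right
  refine ⟨by omega, by omega, ?_⟩
  rw [if_neg h0, if_neg h1, if_neg (by tauto)]
  simp

/-- If the estimates are accurate up to `e` and further than `e` from the threshold, then they are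
on the correct side of it. -/
lemma Accurate.correct {κ : ℕ} (hκ : 1 ≤ κ) (hκK : κ ≤ K + 1)
    (hκμ : ∀ a, 1 ≤ a → a ≤ K → (a < κ ↔ μ a < τ)) (h : Accurate K T τ μ y e i)
    (hfar : ∀ j, ¬(((τ - e : ℝ) : EReal) ≤ nodeEst K T τ y i j ∧
      nodeEst K T τ y i j ≤ ((τ + e : ℝ) : EReal))) : Correct K T τ y κ i := by
  intro j
  have hj := abs_le.1 (h j)
  have hf := hfar j
  rcases nodeEst_cases K T τ μ y i j with ⟨h1, h2⟩ | ⟨h1, h2⟩ | ⟨h1, h2, h3⟩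
  · rw [h1, h2]
    refine ⟨by simp; omega, by simp; omega⟩
  · rw [h1, h2]
    refine ⟨by simp; omega, by simp; omega⟩
  · rw [← not_lt (b := κ), hκμ _ h1 h2, h3]
    rw [h3] at hf
    simp only [EReal.coe_le_coe_iff, not_lt] at hf ⊢
    have he : 0 ≤ e := (abs_nonneg _).trans (h j)
    have hf' : μ (entry K (node K T τ y i) j) + dev K T μ y i (node K T τ y i) j < τ - e ∨
        τ + e < μ (entry K (node K T τ y i) j) + dev K T μ y i (node K T τ y i) j := by
      by_contra hcon
      push Not at hcon
      exact hf hcon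
    rcases hf' with hf' | hf'
    · exact ⟨⟨fun _ => by linarith, fun _ => by linarith⟩,
        ⟨fun _ => by linarith, fun _ => by linarith⟩⟩
    · exact ⟨⟨fun _ => by linarith, fun _ => by linarith⟩,
        ⟨fun _ => by linarith, fun _ => by linarith⟩⟩

/-- The second clause of candidacy fills the gap left by the first: if no outer estimate of an
enclosing leaf is within ε of τ, they lie on opposite sides of τ, further than ε away. -/
lemma Encloses.exists_isCandidate (h : Encloses K T τ y i) :
    ∃ j, IsCandidate K T τ y ε i j := by
  obtain ⟨hl, h0, h2⟩ := h
  by_contra hcon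
  push Not at hcon
  have c0 := hcon 0
  have c2 := hcon 2
  unfold IsCandidate at c0 c2
  push Not at c0 c2
  by_cases hε : 0 ≤ ε
  · have hlo : nodeEst K T τ y i 0 < ((τ - ε : ℝ) : EReal) := by
      by_contra h'
      refine absurd (c0.1 (not_lt.1 h')) (not_lt.2 (h0.trans ?_))
      exact_mod_cast (by linarith : τ ≤ τ + ε)
    refine absurd (c2.2 rfl hl hlo) (not_lt.2 (c2.1 (le_trans ?_ h2)).le)
    exact_mod_cast (by linarith : τ - ε ≤ τ)
  · push Not at hε
    have hlo : nodeEst K T τ y i 0 < ((τ - ε : ℝ) : EReal) := by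
      refine h0.trans_lt ?_
      exact_mod_cast (by linarith : τ < τ - ε)
    refine absurd (c2.2 rfl hl hlo) (not_lt.2 (le_trans ?_ h2))
    exact_mod_cast (by linarith : τ + ε ≤ τ)

/-- At an accurate step every candidate is acceptable. -/
lemma IsCandidate.acceptable (h : Accurate K T τ μ y e i) {j : Fin 3}
    (hμ : ∀ a b, 1 ≤ a → a ≤ b → b ≤ K → μ a ≤ μ b) (hε : 0 ≤ ε)
    (hc : IsCandidate K T τ y ε i j) :
    Acceptable K μ τ (e + ε) (entry K (node K T τ y i) j) := by
  have he : 0 ≤ e := (abs_nonneg _).trans (h 0)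
  have hj := abs_le.1 (h j)
  have hK' := (isNode_node K T τ y i).entry_le j
  rcases hc with ⟨hc1, hc2⟩ | ⟨rfl, hl, hc1, hc2⟩
  · rcases nodeEst_cases K T τ μ y i j with ⟨h1, h2⟩ | ⟨h1, h2⟩ | ⟨h1, h2, h3⟩
    · rw [h2] at hc1; exact absurd hc1 (not_le.2 (EReal.bot_lt_coe _))
    · rw [h2] at hc2; exact absurd hc2 (not_le.2 (EReal.coe_lt_top _))
    · rw [h3] at hc1 hc2
      simp only [EReal.coe_le_coe_iff] at hc1 hc2
      refine ⟨h1, hK', fun _ => by linarith, fun h4 => ?_⟩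
      exact (hμ (entry K (node K T τ y i) j - 1) (entry K (node K T τ y i) j)
        (by omega) (by omega) h2).trans (by linarith)
  -- At a leaf the arm just before the right entry is the left entry, so the two outer estimates
  -- control both sides of the cut.
  · have e0 : entry K (node K T τ y i) 2 = entry K (node K T τ y i) 0 + 1 := hl
    have h0 := abs_le.1 (h 0)
    refine ⟨by omega, hK', fun h4 => ?_, fun h4 => ?_⟩
    · rcases nodeEst_cases K T τ μ y i 2 with ⟨h1, h2⟩ | ⟨h1, h2⟩ | ⟨h1, h2, h3⟩
      · omega
      · omega
      · rw [h3] at hc2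
        simp only [EReal.coe_le_coe_iff] at hc2
        linarith
    · rcases nodeEst_cases K T τ μ y i 0 with ⟨h1, h2⟩ | ⟨h1, h2⟩ | ⟨h1, h2, h3⟩
      · omega
      · omega
      · rw [h3] at hc1
        simp only [EReal.coe_lt_coe_iff] at hc1
        rw [e0, Nat.add_sub_cancel]
        linarith

lemma abs_sub_le_of_mem_Icc {x : EReal} (h1 : ((τ - ε : ℝ) : EReal) ≤ x)
    (h2 : x ≤ ((τ + ε : ℝ) : EReal)) : (x - (τ : EReal)).abs ≤ ENNReal.ofReal ε := by
  induction x using EReal.rec with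
  | bot => exact absurd h1 (not_le.2 (EReal.bot_lt_coe _))
  | top => exact absurd h2 (not_le.2 (EReal.coe_lt_top _))
  | coe x =>
    simp only [EReal.coe_le_coe_iff] at h1 h2
    rw [← EReal.coe_sub, EReal.abs_def]
    exact ENNReal.ofReal_le_ofReal (abs_le.2 ⟨by linarith, by linarith⟩)

lemma mem_Icc_of_abs_sub_le {x : EReal} (hε : 0 ≤ ε) (h : (x - (τ : EReal)).abs ≤ ENNReal.ofReal ε) :
    ((τ - ε : ℝ) : EReal) ≤ x ∧ x ≤ ((τ + ε : ℝ) : EReal) := by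
  induction x using EReal.rec with
  | bot => simp at h
  | top => simp at h
  | coe x =>
    rw [← EReal.coe_sub, EReal.abs_def, ENNReal.ofReal_le_ofReal_iff hε, abs_le] at h
    simp only [EReal.coe_le_coe_iff]
    exact ⟨by linarith, by linarith⟩

variable {σ : ℝ}

lemma eps0_nonneg : 0 ≤ eps0 K T σ := Real.sqrt_nonneg _

lemma two_mul_eps0_le_epsHat : 2 * eps0 K T σ ≤ epsHat K T τ σ y := by
  unfold epsHat
  split_ifs
  · exact le_rfl
  · exact le_max_left _ _

lemma epsHat_nonneg : 0 ≤ epsHat K T τ σ y :=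
  le_trans (by have := @eps0_nonneg K T σ; positivity) two_mul_eps0_le_epsHat

/-- If `ε̂` exceeds `e ≥ 2 ε₀`, then no step is at an enclosing leaf, and all estimates are further
than `e` from the threshold. -/
lemma far_of_lt_epsHat (he : 2 * eps0 K T σ ≤ e) (hlt : e < epsHat K T τ σ y) (i : Fin (T₁ K)) :
    ¬Encloses K T τ y i ∧ ∀ j, ¬(((τ - e : ℝ) : EReal) ≤ nodeEst K T τ y i j ∧
      nodeEst K T τ y i j ≤ ((τ + e : ℝ) : EReal)) := by
  have he0 : 0 ≤ e := le_trans (by have := @eps0_nonneg K T σ; positivity) he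
  unfold epsHat at hlt
  split_ifs at hlt with h
  · linarith
  · refine ⟨fun h' => h ⟨i, h'⟩, fun j hj => ?_⟩
    rcases lt_max_iff.1 hlt with h1 | h1
    · linarith
    · have h2 := abs_sub_le_of_mem_Icc hj.1 hj.2
      have h3 : (⨅ (i : Fin (T₁ K)) (j : Fin 3), (nodeEst K T τ y i j - (τ : EReal)).abs) ≤
        ENNReal.ofReal e := (iInf₂_le i j).trans h2
      have h4 := ENNReal.toReal_mono ENNReal.ofReal_ne_top h3
      rw [ENNReal.toReal_ofReal he0] at h4
      linarith

open Classical in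
/-- If most steps are accurate up to `e ≥ 2 ε₀`, then `ε̂ ≤ e`. -/
lemma epsHat_le (hμ : ∀ a b, 1 ≤ a → a ≤ b → b ≤ K → μ a ≤ μ b) (he : 2 * eps0 K T σ ≤ e)
    (hbad : 2 * (Finset.univ.filter fun i : Fin (T₁ K) => ¬Accurate K T τ μ y e i).card +
      (Nat.log 2 K + 1) < T₁ K) : epsHat K T τ σ y ≤ e := by
  obtain ⟨κ, hκ, hκK, hκμ⟩ := exists_boundary K μ hμ τ
  by_contra hlt
  push Not at hlt
  -- If ε̂ exceeded `e`, every accurate step would be correct and away from enclosing leaves: more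
  -- such steps than the walk permits.
  have h1 := two_mul_card_le hκ hκK T τ y (T₁ K)
    (Finset.univ.filter fun i : Fin (T₁ K) => Accurate K T τ μ y e i) (by
      intro i hi
      have h2 := far_of_lt_epsHat he hlt i
      exact ⟨(Finset.mem_filter.1 hi).2.correct hκ hκK hκμ h2.2, h2.1⟩)
  have h2 := Finset.card_filter_add_card_filter_not (s := (Finset.univ : Finset (Fin (T₁ K))))
    (fun i => Accurate K T τ μ y e i)
  rw [Finset.card_univ, Fintype.card_fin] at h2
  omega

open Classical in
/-- If most steps are accurate up to `2 ε₀`, then the steps with a candidate outnumber the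
inaccurate ones. -/
lemma card_lt_card_candidate (hμ : ∀ a b, 1 ≤ a → a ≤ b → b ≤ K → μ a ≤ μ b)
    (hbad : 4 * (Finset.univ.filter fun i : Fin (T₁ K) =>
      ¬Accurate K T τ μ y (2 * eps0 K T σ) i).card + (Nat.log 2 K + 1) < T₁ K) :
    (Finset.univ.filter fun i : Fin (T₁ K) => ¬Accurate K T τ μ y (2 * eps0 K T σ) i).card <
    (Finset.univ.filter fun i : Fin (T₁ K) => Accurate K T τ μ y (2 * eps0 K T σ) i ∧
      ∃ j, IsCandidate K T τ y (epsHat K T τ σ y) i j).card := by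
  obtain ⟨κ, hκ, hκK, hκμ⟩ := exists_boundary K μ hμ τ
  -- An accurate step without a candidate has all estimates further than ε̂ ≥ 2 ε₀ from τ and is not
  -- at an enclosing leaf, so the walk limits the number of such steps.
  have h1 := two_mul_card_le hκ hκK T τ y (T₁ K)
    (Finset.univ.filter fun i : Fin (T₁ K) => Accurate K T τ μ y (2 * eps0 K T σ) i ∧
      ¬∃ j, IsCandidate K T τ y (epsHat K T τ σ y) i j) (by
      intro i hi
      obtain ⟨h2, h3⟩ := (Finset.mem_filter.1 hi).2
      refine ⟨h2.correct hκ hκK hκμ fun j hj => h3 ⟨j, Or.inl ⟨?_, ?_⟩⟩,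
        fun h => h3 h.exists_isCandidate⟩
      · refine le_trans ?_ hj.1
        exact_mod_cast sub_le_sub_left two_mul_eps0_le_epsHat τ
      · refine le_trans hj.2 ?_
        exact_mod_cast add_le_add_right two_mul_eps0_le_epsHat τ)
  have h2 := Finset.card_filter_add_card_filter_not (s := (Finset.univ : Finset (Fin (T₁ K))))
    (fun i => Accurate K T τ μ y (2 * eps0 K T σ) i)
  have h3 := Finset.card_filter_add_card_filter_not
    (s := Finset.univ.filter fun i : Fin (T₁ K) => Accurate K T τ μ y (2 * eps0 K T σ) i)
    (fun i => ∃ j, IsCandidate K T τ y (epsHat K T τ σ y) i j)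
  rw [Finset.card_univ, Fintype.card_fin] at h2
  rw [Finset.filter_filter, Finset.filter_filter] at h3
  omega

/-- Some step has a candidate. -/
lemma exists_isCandidate (hK : 1 ≤ K) (hT : 0 < T₁ K) :
    ∃ (i : Fin (T₁ K)) (j : Fin 3), IsCandidate K T τ y (epsHat K T τ σ y) i j := by
  by_cases h : ∃ i : Fin (T₁ K), Encloses K T τ y i
  · obtain ⟨i, hi⟩ := h
    exact ⟨i, hi.exists_isCandidate⟩
  · have : Nonempty (Fin (T₁ K)) := ⟨⟨0, hT⟩⟩
    obtain ⟨⟨i, j⟩, hij⟩ := exists_eq_ciInf_of_finite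
      (f := fun q : Fin (T₁ K) × Fin 3 => (nodeEst K T τ y q.1 q.2 - (τ : EReal)).abs)
    refine ⟨i, j, Or.inl (mem_Icc_of_abs_sub_le epsHat_nonneg ?_)⟩
    rw [iInf_prod] at hij
    have hfin : (nodeEst K T τ y i j - (τ : EReal)).abs ≠ ⊤ := by
      simp only at hij
      rw [hij]
      -- The middle entry of the root is a genuine arm, so the least distance is finite and its
      -- `toReal` is not the default value 0.
      refine ne_top_of_le_ne_top ?_ (iInf₂_le (⟨0, hT⟩ : Fin (T₁ K)) (1 : Fin 3))
      have e1 : entry K (node K T τ y 0) 1 = (K + 1) / 2 := by simp [entry, node, ends]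
      rcases nodeEst_cases K T τ 0 y 0 1 with ⟨h1, _⟩ | ⟨h1, _⟩ | ⟨_, _, h3⟩
      · omega
      · omega
      · simp only [h3]
        rw [← EReal.coe_sub, EReal.abs_def]
        exact ENNReal.ofReal_ne_top
    refine (ENNReal.le_ofReal_iff_toReal_le hfin epsHat_nonneg).2 ?_
    rw [epsHat, if_neg h, ← hij]
    exact le_max_right _ _

lemma selected_spec {s : Seed K} {i : Fin (T₁ K)} {a : ℕ} (h : selected K T τ σ s y i = some a) :
    ∃ j, IsCandidate K T τ y (epsHat K T τ σ y) i j ∧ entry K (node K T τ y i) j = a := by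
  unfold selected at h
  simp only at h
  split_ifs at h with h1 h2 h3
  · exact ⟨_, h1, by simpa using h⟩
  · exact ⟨_, h2, by simpa using h⟩
  · exact ⟨_, h3, by simpa using h⟩

lemma selected_isSome {s : Seed K} {i : Fin (T₁ K)} {j : Fin 3}
    (h : IsCandidate K T τ y (epsHat K T τ σ y) i j) : (selected K T τ σ s y i).isSome := by
  unfold selected
  simp only
  split_ifs with h1 h2 h3
  · simp
  · simp
  · simp
  · obtain ⟨k, rfl⟩ := (s i).surjective j
    fin_cases k
    · exact absurd h h1
    · exact absurd h h2
    · exact absurd h h3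

lemma chosen_acceptable_of_median {s : Seed K} {r : ℝ}
    (hμ : ∀ a b, 1 ≤ a → a ≤ b → b ≤ K → μ a ≤ μ b) [DecidablePred (Acceptable K μ τ r)]
    (h : ((List.finRange (T₁ K)).filterMap (selected K T τ σ s y)).length <
      2 * ((List.finRange (T₁ K)).filterMap (selected K T τ σ s y)).countP
        (fun a => decide (Acceptable K μ τ r a))) :
    Acceptable K μ τ r (chosen K T τ σ s y) := by
  exact median_mem_of_countP (fun a b c hab hbc ha hc => ha.of_mem_Icc hμ hab hbc hc) h

lemma countP_finRange_eq_card {n : ℕ} (P : Fin n → Prop) [DecidablePred P] :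
    (List.finRange n).countP (fun i => decide (P i)) = (Finset.univ.filter P).card := by
  rw [List.countP_eq_length_filter, Fin.univ_def]
  rfl

open Classical in
/-- If most steps are accurate up to `2 ε₀`, then the chosen arm is acceptable up to `4 ε₀`. -/
lemma chosen_acceptable (hμ : ∀ a b, 1 ≤ a → a ≤ b → b ≤ K → μ a ≤ μ b)
    (hbad : 4 * (Finset.univ.filter fun i : Fin (T₁ K) =>
      ¬Accurate K T τ μ y (2 * eps0 K T σ) i).card + (Nat.log 2 K + 1) < T₁ K) (s : Seed K) :
    Acceptable K μ τ (4 * eps0 K T σ) (chosen K T τ σ s y) := by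
  apply chosen_acceptable_of_median hμ
  have hε : epsHat K T τ σ y ≤ 2 * eps0 K T σ := epsHat_le hμ le_rfl (by omega)
  have hε' : epsHat K T τ σ y = 2 * eps0 K T σ := le_antisymm hε two_mul_eps0_le_epsHat
  set l := (List.finRange (T₁ K)).filterMap (selected K T τ σ s y) with hl
  have h1 := List.length_eq_countP_add_countP (fun a => decide (Acceptable K μ τ (4 * eps0 K T σ) a))
    (l := l)
  -- Accurate steps with a candidate contribute acceptable arms; unacceptable ones can come from
  -- inaccurate steps only.
  have h2 : (Finset.univ.filter fun i : Fin (T₁ K) => Accurate K T τ μ y (2 * eps0 K T σ) i ∧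
      ∃ j, IsCandidate K T τ y (epsHat K T τ σ y) i j).card ≤
      l.countP (fun a => decide (Acceptable K μ τ (4 * eps0 K T σ) a)) := by
    rw [hl, List.countP_filterMap, ← countP_finRange_eq_card]
    refine List.countP_mono_left fun i _ hi => ?_
    obtain ⟨hi1, j, hij⟩ := of_decide_eq_true hi
    obtain ⟨a, ha⟩ := Option.isSome_iff_exists.1 (selected_isSome (s := s) hij)
    obtain ⟨j', hj', rfl⟩ := selected_spec ha
    have := hj'.acceptable hi1 hμ epsHat_nonneg
    rw [hε', show 2 * eps0 K T σ + 2 * eps0 K T σ = 4 * eps0 K T σ by ring] at this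
    simp [ha, this]
  have h3 : l.countP (fun a => !decide (Acceptable K μ τ (4 * eps0 K T σ) a)) ≤
      (Finset.univ.filter fun i : Fin (T₁ K) => ¬Accurate K T τ μ y (2 * eps0 K T σ) i).card := by
    rw [hl, List.countP_filterMap, ← countP_finRange_eq_card]
    refine List.countP_mono_left fun i _ hi => ?_
    simp only [decide_eq_true_eq]
    intro hi1
    cases ha : selected K T τ σ s y i with
    | none => simp [ha] at hi
    | some a =>
      obtain ⟨j', hj', rfl⟩ := selected_spec ha
      have := hj'.acceptable hi1 hμ epsHat_nonneg
      rw [hε', show 2 * eps0 K T σ + 2 * eps0 K T σ = 4 * eps0 K T σ by ring] at this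
      simp [ha, this] at hi
  have h4 := card_lt_card_candidate hμ hbad
  simp only [Bool.not_eq_true, decide_eq_false_iff_not, decide_not] at h1
  omega

/-- If all steps are accurate up to `e`, then the chosen arm is acceptable up to `2 e`. -/
lemma chosen_acceptable_of_forall (hK : 1 ≤ K) (hT : Nat.log 2 K + 1 < T₁ K)
    (hμ : ∀ a b, 1 ≤ a → a ≤ b → b ≤ K → μ a ≤ μ b) (he : 2 * eps0 K T σ ≤ e)
    (hacc : ∀ i : Fin (T₁ K), Accurate K T τ μ y e i) (s : Seed K) :
    Acceptable K μ τ (2 * e) (chosen K T τ σ s y) := by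
  classical
  apply chosen_acceptable_of_median hμ
  have hε : epsHat K T τ σ y ≤ e := by
    refine epsHat_le hμ he ?_
    rw [Finset.card_eq_zero.2]
    · omega
    · simpa [Finset.filter_eq_empty_iff] using hacc
  obtain ⟨i, j, hij⟩ := exists_isCandidate (K := K) (T := T) (τ := τ) (y := y) (σ := σ) hK (by omega)
  set l := (List.finRange (T₁ K)).filterMap (selected K T τ σ s y) with hl
  have hpos : 0 < l.length := by
    obtain ⟨a, ha⟩ := Option.isSome_iff_exists.1 (selected_isSome (s := s) hij)
    exact List.length_pos_of_mem (List.mem_filterMap.2 ⟨i, List.mem_finRange i, ha⟩)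
  have hall : l.countP (fun a => decide (Acceptable K μ τ (2 * e) a)) = l.length := by
    rw [List.countP_eq_length]
    intro a ha
    obtain ⟨i, _, hi⟩ := List.mem_filterMap.1 ha
    obtain ⟨j, hj, rfl⟩ := selected_spec hi
    have h1 := hj.acceptable (hacc i) hμ epsHat_nonneg
    simp only [decide_eq_true_eq]
    exact ⟨h1.1, h1.2.1, fun h => le_trans (by linarith) (h1.2.2.1 h),
      fun h => (h1.2.2.2 h).trans (by linarith)⟩
  omega

end

/-- The regret of the classification that puts the boundary below an acceptable arm. -/
lemma Acceptable.regret_le {K : ℕ} {ν : Fin K → ProbabilityMeasure ℝ}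
    (hν : Monotone fun k => mean (ν k)) {μ : ℕ → ℝ} (hμ : ∀ k : Fin K, μ (k + 1) = mean (ν k))
    {τ r : ℝ} {a : ℕ} (h : Acceptable K μ τ r a) :
    regret τ ν (fun k => decide (a ≤ (k : ℕ) + 1)) ≤ ENNReal.ofReal r := by
  refine iSup₂_le fun k hk => ENNReal.ofReal_le_ofReal ?_
  obtain ⟨h1, haK, h2, h3⟩ := h
  simp only [decide_eq_true_eq] at hk
  have hk' := k.2
  -- A mislabelled arm from the cut on has its mean in [μ a, τ); one before the cut has it in [τ, μ
  -- (a - 1)].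
  by_cases hak : a ≤ (k : ℕ) + 1
  · have hlt : mean (ν k) < τ := by
      by_contra h'
      exact hk ⟨fun _ => not_lt.1 h', fun _ => hak⟩
    have ha := h2 (by omega)
    have hle : (⟨a - 1, by omega⟩ : Fin K) ≤ k := by
      rw [Fin.le_def]; simp only; omega
    have h4 := hμ ⟨a - 1, by omega⟩
    simp only [Nat.sub_add_cancel h1] at h4
    have h5 := hν hle
    simp only at h5
    rw [abs_of_pos (by linarith)]
    linarith
  · have hge : τ ≤ mean (ν k) := by
      by_contra h'
      exact hk ⟨fun h => absurd h hak, fun h => absurd h h'⟩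
    rw [abs_of_nonpos (by linarith)]
    have ha := h3 (by omega)
    have hle : k ≤ (⟨a - 2, by omega⟩ : Fin K) := by
      rw [Fin.le_def]; simp only; omega
    have h4 := hμ ⟨a - 2, by omega⟩
    have h6 : a - 2 + 1 = a - 1 := by omega
    simp only [h6] at h4
    have h5 := hν hle
    simp only at h5
    linarith

end ThresholdBandit.MTB

namespace ThresholdBandit

/-! ### The interaction -/

namespace Strategy

variable {K T : ℕ} (π : Strategy K T)

lemma rewards_congr (s : π.Seed) {x x' : Fin T → Fin K → ℝ} {t : ℕ} (ht : t ≤ T)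
    (h : ∀ i : Fin T, (i : ℕ) < t → x i = x' i) : π.rewards s x t ht = π.rewards s x' t ht := by
  induction t with
  | zero => rfl
  | succ t ih =>
    have h1 := ih (Nat.le_of_succ_le ht) fun i hi => h i (Nat.lt_succ_of_lt hi)
    simp only [rewards]
    rw [h1, h ⟨t, ht⟩ (Nat.lt_succ_self t)]

lemma rewards_apply (s : π.Seed) (x : Fin T → Fin K → ℝ) {t : ℕ} (ht : t ≤ T) (n : Fin t) :
    π.rewards s x t ht n = x ⟨n, n.2.trans_le ht⟩
      (π.pull ⟨n, n.2.trans_le ht⟩ (s, π.rewards s x n (n.2.le.trans ht))) := by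
  induction t with
  | zero => exact n.elim0
  | succ t ih =>
    induction n using Fin.lastCases with
    | last => simp [rewards]
    | cast n =>
      simp only [rewards, Fin.snoc_castSucc]
      exact ih (Nat.le_of_succ_le ht) n

lemma measurable_apply_arm {α : Type*} [MeasurableSpace α] {f : α → Fin K → ℝ} {a : α → Fin K}
    (hf : Measurable f) (ha : Measurable a) : Measurable fun z => f z (a z) := by
  refine (measurable_from_prod_countable_right (f := fun z : Fin K × (Fin K → ℝ) => z.2 z.1)
    fun k => measurable_pi_apply k).comp (ha.prodMk hf)

lemma measurable_rewards {t : ℕ} (ht : t ≤ T) :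
    Measurable fun z : π.Seed × (Fin T → Fin K → ℝ) => π.rewards z.1 z.2 t ht := by
  induction t with
  | zero => exact measurable_pi_lambda _ fun i => i.elim0
  | succ t ih =>
    have h1 := ih (Nat.le_of_succ_le ht)
    refine measurable_pi_lambda _ fun i => ?_
    induction i using Fin.lastCases with
    | last =>
      simp only [rewards, Fin.snoc_last]
      exact measurable_apply_arm ((measurable_pi_apply _).comp measurable_snd)
        ((π.measurable_pull _).comp (measurable_fst.prodMk h1))
    | cast i =>
      simp only [rewards, Fin.snoc_castSucc]
      exact (measurable_pi_apply i).comp h1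

end Strategy

instance {K T : ℕ} (ν : Fin K → ProbabilityMeasure ℝ) : IsProbabilityMeasure (tableLaw T ν) := by
  unfold tableLaw
  infer_instance

/-! ### Functions of disjoint sets of coordinates -/

section Product

variable {ι : Type*} [Fintype ι] {X : Type*} [MeasurableSpace X] {ρ : ι → Measure X}
  [∀ i, IsProbabilityMeasure (ρ i)] {S : Finset ι}

/-- As `B` ignores `S`, integrating out the other coordinates leaves a constant, which integration
over `S` preserves. -/
lemma lmarginal_compl_eq_lintegral [DecidableEq ι] {B : (ι → X) → ℝ≥0∞} (hB : Measurable B)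
    (hBS : DependsOn B (Sᶜ : Set ι)) (x : ι → X) :
    (∫⋯∫⁻_Sᶜ, B ∂ρ) x = ∫⁻ z, B z ∂Measure.pi ρ := by
  have hconst : ∀ z, (∫⋯∫⁻_Sᶜ, B ∂ρ) z = (∫⋯∫⁻_Sᶜ, B ∂ρ) x := by
    intro z
    simp only [lmarginal]
    refine lintegral_congr fun w => hBS fun i hi => ?_
    have hi' : i ∈ Sᶜ := by simpa using hi
    simp [Function.updateFinset, hi']
  rw [lintegral_eq_lmarginal_univ x, ← Finset.union_compl S,
    lmarginal_union ρ B hB disjoint_compl_right]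
  have : (∫⋯∫⁻_Sᶜ, B ∂ρ) = fun _ => (∫⋯∫⁻_Sᶜ, B ∂ρ) x := funext hconst
  rw [this]
  simp [lmarginal]

lemma lintegral_mul_of_dependsOn {A B : (ι → X) → ℝ≥0∞} (hA : Measurable A) (hB : Measurable B)
    (hAS : DependsOn A (S : Set ι)) (hBS : DependsOn B (Sᶜ : Set ι)) :
    ∫⁻ x, A x * B x ∂Measure.pi ρ = (∫⁻ x, A x ∂Measure.pi ρ) * ∫⁻ x, B x ∂Measure.pi ρ := by
  classical
  rw [← lintegral_mul_const _ hA]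
  refine lintegral_eq_of_lmarginal_eq Sᶜ (hA.mul hB) (hA.mul_const _) ?_
  funext x
  have hAx : ∀ w, A (Function.updateFinset x Sᶜ w) = A x := by
    intro w
    refine hAS fun i hi => ?_
    have hi' : i ∉ Sᶜ := by simpa using hi
    simp [Function.updateFinset, hi']
  have h1 : Measurable fun w : ((i : ↥(Sᶜ : Finset ι)) → X) => B (Function.updateFinset x Sᶜ w) :=
    hB.comp measurable_updateFinset
  rw [lmarginal, lmarginal]
  simp only [hAx]
  rw [lintegral_const_mul _ h1, ← lmarginal_compl_eq_lintegral hB hBS x]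
  simp [lmarginal]

/-- If `N` and `A` depend on the coordinates in `S` only and the functions `h p` on the other
coordinates only, then `h (N x) x` may be integrated first. -/
lemma lintegral_mul_le_of_dependsOn {β : Type*} [Countable β] [MeasurableSpace β]
    [MeasurableSingletonClass β] {N : (ι → X) → β} {A : (ι → X) → ℝ≥0∞} {h : β → (ι → X) → ℝ≥0∞}
    (hN : Measurable N) (hA : Measurable A) (hh : ∀ p, Measurable (h p))
    (hNS : DependsOn N (S : Set ι)) (hAS : DependsOn A (S : Set ι))
    (hhS : ∀ p, DependsOn (h p) (Sᶜ : Set ι)) {c : ℝ≥0∞}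
    (hc : ∀ p, ∫⁻ x, h p x ∂Measure.pi ρ ≤ c) :
    ∫⁻ x, A x * h (N x) x ∂Measure.pi ρ ≤ c * ∫⁻ x, A x ∂Measure.pi ρ := by
  classical
  -- Splitting over the countably many values of `N` makes the random index deterministic on each
  -- piece.
  let A' : β → (ι → X) → ℝ≥0∞ := fun p x => A x * Set.indicator {x | N x = p} 1 x
  have hA' : ∀ p, Measurable (A' p) := fun p =>
    hA.mul (measurable_one.indicator (hN (measurableSet_singleton p)))
  have hsum : ∀ x, ∑' p, A' p x = A x := by
    intro x
    rw [tsum_eq_single (N x)]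
    · simp [A']
    · intro p hp
      simp [A', Ne.symm hp]
  have hsum' : ∀ x, ∑' p, A' p x * h p x = A x * h (N x) x := by
    intro x
    rw [tsum_eq_single (N x)]
    · simp [A']
    · intro p hp
      simp [A', Ne.symm hp]
  rw [← lintegral_congr hsum', ← lintegral_congr hsum]
  rw [lintegral_tsum (f := fun p x => A' p x * h p x) fun p => ((hA' p).mul (hh p)).aemeasurable,
    lintegral_tsum fun p => (hA' p).aemeasurable, ← ENNReal.tsum_mul_left]
  refine ENNReal.tsum_le_tsum fun p => ?_
  rw [lintegral_mul_of_dependsOn (S := S) (hA' p) (hh p) ?_ (hhS p), mul_comm]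
  · exact mul_le_mul_left (hc p) _
  · intro x x' hx
    simp only [A', Set.indicator, Set.mem_ofPred_eq, hNS hx, hAS hx, Pi.one_apply]

end Product

end ThresholdBandit

namespace ThresholdBandit.MTB

/-! ### The rewards observed by MTB -/

lemma average_congr {K T i : ℕ} {y y' : ℕ → ℝ} (j : Fin 3)
    (h : ∀ n, n / (3 * T₂ K T) = i → n % (3 * T₂ K T) / T₂ K T = j → y n = y' n) :
    average K T y i j = average K T y' i j := by
  unfold average
  congr 1
  refine Finset.sum_congr rfl fun s hs => ?_
  have hs' := Finset.mem_range.1 hs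
  have hj := j.2
  have hlt : (j : ℕ) * T₂ K T + s < 3 * T₂ K T := by nlinarith
  apply h
  · rw [add_assoc, mul_comm i, Nat.mul_add_div (by omega), Nat.div_eq_of_lt hlt, add_zero]
  · rw [add_assoc, mul_comm i, Nat.mul_add_mod, Nat.mod_eq_of_lt hlt, mul_comm,
      Nat.mul_add_div (by omega), Nat.div_eq_of_lt hs', add_zero]

lemma node_congr {K T i : ℕ} {τ : ℝ} {y y' : ℕ → ℝ} (h : ∀ n, n / (3 * T₂ K T) < i → y n = y' n) :
    node K T τ y i = node K T τ y' i := by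
  induction i with
  | zero => rfl
  | succ i ih =>
    have h1 := ih fun n hn => h n (by omega)
    have h2 : ∀ p j, est K T y i p j = est K T y' i p j := by
      intro p j
      unfold est
      rw [average_congr j fun n hn _ => h n (by omega)]
    rw [node, node, h1]
    congr 1
    funext j
    exact h2 _ j

/-- The rewards that are observed by pulling the arm `a` in all rounds. -/
noncomputable def armRewards {K T : ℕ} (x : Fin T → Fin K → ℝ) (a : Fin K) (n : ℕ) : ℝ :=
  if h : n < T then x ⟨n, h⟩ a else 0

/-- The rewards observed by MTB. -/
noncomputable def observed {K T : ℕ} (hK : 0 < K) (τ σ : ℝ) (s : (mtb K T hK τ σ).Seed) (x : Fin T → Fin K → ℝ) :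
    ℕ → ℝ :=
  extend ((mtb K T hK τ σ).rewards s x T le_rfl)

section

variable {K T : ℕ} {hK : 0 < K} {τ σ : ℝ} {s : (mtb K T hK τ σ).Seed} {x : Fin T → Fin K → ℝ}

/-- The strategy sees only the past, padded with zeros. The current node depends on earlier steps
only, so the past and the full record yield the same node. -/
lemma observed_eq (n : ℕ) : observed hK τ σ s x n =
    armRewards x (toArm K hK (entry K (node K T τ (observed hK τ σ s x) (n / (3 * T₂ K T)))
      (Fin.ofNat 3 (n % (3 * T₂ K T) / T₂ K T)))) n := by
  by_cases hn : n < T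
  · have h1 : node K T τ (extend ((mtb K T hK τ σ).rewards s x n hn.le)) (n / (3 * T₂ K T)) =
        node K T τ (observed hK τ σ s x) (n / (3 * T₂ K T)) := by
      refine node_congr fun m hm => ?_
      have hmn : m < n := by
        by_contra hcon
        exact absurd (Nat.div_le_div_right (not_lt.1 hcon)) (not_le.2 hm)
      have hmT : m < T := hmn.trans hn
      simp only [observed, extend, hmn, hmT, dif_pos]
      rw [Strategy.rewards_apply, Strategy.rewards_apply]
    rw [← h1]
    conv_lhs => rw [observed, extend, dif_pos hn, Strategy.rewards_apply]
    rw [armRewards, dif_pos hn]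
    rfl
  · simp [observed, extend, armRewards, hn]

/-- All rounds of one slot pull the same arm, so adaptivity enters only through the visited node:
the rest is the deviation of a fixed column of the table. -/
lemma dev_observed (μ : ℕ → ℝ) (i : ℕ) (j : Fin 3) :
    dev K T μ (observed hK τ σ s x) i (node K T τ (observed hK τ σ s x) i) j =
    dev K T μ (armRewards x (toArm K hK (entry K (node K T τ (observed hK τ σ s x) i) j))) i
      (node K T τ (observed hK τ σ s x) i) j := by
  unfold dev
  congr 2
  refine average_congr j fun n hn hj => ?_
  rw [observed_eq n, hn, hj]
  congr 4
  simp

lemma node_observed_congr {i : ℕ} {x' : Fin T → Fin K → ℝ}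
    (h : ∀ n : Fin T, (n : ℕ) / (3 * T₂ K T) < i → x n = x' n) :
    node K T τ (observed hK τ σ s x) i = node K T τ (observed hK τ σ s x') i := by
  refine node_congr fun n hn => ?_
  unfold observed extend
  split_ifs with hnT
  · rw [Strategy.rewards_apply, Strategy.rewards_apply, h ⟨n, hnT⟩ hn]
    rw [Strategy.rewards_congr (x' := x')]
    intro m hm
    exact h m (lt_of_le_of_lt (Nat.div_le_div_right hm.le) hn)
  · rfl

lemma measurable_observed : Measurable fun z : (mtb K T hK τ σ).Seed × (Fin T → Fin K → ℝ) =>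
    observed hK τ σ z.1 z.2 :=
  (measurable_extend T).comp ((mtb K T hK τ σ).measurable_rewards le_rfl)

end

/-! ### Exponential moments of the deviations -/

/-- The mean of the arm `a ∈ {1, …, K}`. -/
noncomputable def armMean {K : ℕ} (hK : 0 < K) (ν : Fin K → ProbabilityMeasure ℝ) (a : ℕ) : ℝ :=
  mean (ν (toArm K hK a))

lemma armMean_succ {K : ℕ} (hK : 0 < K) (ν : Fin K → ProbabilityMeasure ℝ) (k : Fin K) :
    armMean hK ν (k + 1) = mean (ν k) := by
  simp [armMean, toArm]

lemma armMean_mono {K : ℕ} (hK : 0 < K) {ν : Fin K → ProbabilityMeasure ℝ}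
    (hν : Monotone fun k => mean (ν k)) (a b : ℕ) (ha : 1 ≤ a) (hab : a ≤ b) (hb : b ≤ K) :
    armMean hK ν a ≤ armMean hK ν b := by
  unfold armMean toArm
  rw [dif_pos (by omega), dif_pos (by omega)]
  exact hν (by rw [Fin.le_def]; simp only; omega)

/-- The deviation of the estimate for entry `j` of the node `p`, if this node is visited in step
`i`. -/
noncomputable def tableDev {K T : ℕ} (hK : 0 < K) (ν : Fin K → ProbabilityMeasure ℝ) (i : ℕ)
    (p : List Bool) (j : Fin 3) (x : Fin T → Fin K → ℝ) : ℝ :=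
  dev K T (armMean hK ν) (armRewards x (toArm K hK (entry K p j))) i p j

section

variable {K T : ℕ} {hK : 0 < K} {ν : Fin K → ProbabilityMeasure ℝ}

lemma measurable_armRewards (a : Fin K) :
    Measurable fun x : Fin T → Fin K → ℝ => armRewards x a := by
  refine measurable_pi_lambda _ fun n => ?_
  unfold armRewards
  split_ifs
  · fun_prop
  · fun_prop

lemma measurable_tableDev (i : ℕ) (p : List Bool) (j : Fin 3) :
    Measurable (tableDev (T := T) hK ν i p j) := by
  unfold tableDev dev
  split_ifs
  · exact measurable_const
  · exact ((measurable_average K T i j).comp (measurable_armRewards _)).sub_const _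

lemma tableDev_congr {i : ℕ} (p : List Bool) (j : Fin 3)
    {x x' : Fin T → Fin K → ℝ} (h : ∀ n : Fin T, (n : ℕ) / (3 * T₂ K T) = i → x n = x' n) :
    tableDev hK ν i p j x = tableDev hK ν i p j x' := by
  unfold tableDev dev
  congr 2
  refine average_congr j fun n hn _ => ?_
  unfold armRewards
  split_ifs with hnT
  · rw [h ⟨n, hnT⟩ hn]
  · rfl

lemma lintegral_exp_le_of_hasSubgaussianMGF {Ω : Type*} [MeasurableSpace Ω] {P : Measure Ω}
    {X : Ω → ℝ} {c : ℝ≥0} (h : HasSubgaussianMGF X c P) (t : ℝ) :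
    ∫⁻ ω, ENNReal.ofReal (Real.exp (t * X ω)) ∂P ≤ ENNReal.ofReal (Real.exp (c * t ^ 2 / 2)) := by
  rw [← ofReal_integral_eq_lintegral_ofReal (h.integrable_exp_mul t)
    (Filter.Eventually.of_forall fun _ => (Real.exp_pos _).le)]
  exact ENNReal.ofReal_le_ofReal (h.mgf_le t)

lemma hasSubgaussianMGF_table {c : ℝ≥0} {k : Fin K}
    (h : HasSubgaussianMGF (fun x => x - mean (ν k)) c (ν k : Measure ℝ)) (t : Fin T) :
    HasSubgaussianMGF (fun x : Fin T → Fin K → ℝ => x t k - mean (ν k)) c (tableLaw T ν) := by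
  have h1 : MeasurePreserving (fun x : Fin T → Fin K → ℝ => x t k) (tableLaw T ν) (ν k : Measure ℝ) :=
    (measurePreserving_eval (fun k : Fin K => (ν k : Measure ℝ)) k).comp
      (measurePreserving_eval (fun _ : Fin T => Measure.pi fun k : Fin K => (ν k : Measure ℝ)) t)
  refine HasSubgaussianMGF.of_map (X := fun x => x - mean (ν k)) h1.aemeasurable ?_
  rwa [h1.map_eq]

lemma iIndepFun_table (k : Fin K) (m : ℝ) :
    iIndepFun (fun (t : Fin T) (x : Fin T → Fin K → ℝ) => x t k - m) (tableLaw T ν) :=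
  have hm : Measurable fun r : Fin K → ℝ => r k - m := by fun_prop
  iIndepFun_pi (X := fun _ (r : Fin K → ℝ) => r k - m) fun _ => hm.aemeasurable

/-- At a fixed node the deviation is a centred average of T₂ independent entries of one column,
which divides the variance proxy by T₂; deterministic arms have deviation 0. -/
lemma lintegral_exp_tableDev_le {c : ℝ≥0}
    (h : ∀ k, HasSubgaussianMGF (fun x => x - mean (ν k)) c (ν k : Measure ℝ))
    (hT : 0 < T₂ K T) {i : ℕ} (hi : i < T₁ K) (p : List Bool) (j : Fin 3) (t : ℝ) :
    ∫⁻ x, ENNReal.ofReal (Real.exp (t * tableDev hK ν i p j x)) ∂tableLaw T ν ≤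
      ENNReal.ofReal (Real.exp (c * t ^ 2 / (2 * T₂ K T))) := by
  by_cases hp : entry K p j = 0 ∨ entry K p j = K + 1
  · simp only [tableDev, dev, if_pos hp, mul_zero, Real.exp_zero]
    simp only [lintegral_const, measure_univ, mul_one]
    exact ENNReal.ofReal_le_ofReal (Real.one_le_exp (by positivity))
  set k := toArm K hK (entry K p j) with hk
  have hrow : ∀ s : Fin (T₂ K T), i * (3 * T₂ K T) + j * T₂ K T + s < T := by
    intro s
    have h1 : T₂ K T * (3 * T₁ K) ≤ T := Nat.div_mul_le_self _ _
    have h2 := j.2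
    have h3 := s.2
    have h4 : (i + 1) * (3 * T₂ K T) ≤ T₁ K * (3 * T₂ K T) := Nat.mul_le_mul_right _ hi
    nlinarith
  let row : Fin (T₂ K T) → Fin T := fun s => ⟨_, hrow s⟩
  have hinj : Function.Injective row := by
    intro a b hab
    have := congrArg Fin.val hab
    simp only [row] at this
    exact Fin.ext (by omega)
  have hsum := HasSubgaussianMGF.sum_of_iIndepFun
    ((iIndepFun_table (T := T) (ν := ν) k (mean (ν k))).precomp hinj) (s := Finset.univ)
    (c := fun _ => c) (fun s _ => hasSubgaussianMGF_table (h k) (row s))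
  have hpos : (0 : ℝ) < T₂ K T := by exact_mod_cast hT
  have heq : ∀ x : Fin T → Fin K → ℝ, t * tableDev hK ν i p j x =
      (t / T₂ K T) * ∑ s, (x (row s) k - mean (ν k)) := by
    intro x
    have : average K T (armRewards x k) i j = (∑ s, x (row s) k) / T₂ K T := by
      unfold average
      rw [Finset.sum_range]
      congr 1
      refine Finset.sum_congr rfl fun s _ => ?_
      rw [armRewards, dif_pos (hrow s)]
    rw [tableDev, dev, if_neg hp, ← hk, this, Finset.sum_sub_distrib, armMean, ← hk]
    simp only [Finset.sum_const, Finset.card_univ, Fintype.card_fin, nsmul_eq_mul]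
    field_simp
  simp only [heq]
  refine (lintegral_exp_le_of_hasSubgaussianMGF hsum _).trans (ENNReal.ofReal_le_ofReal ?_)
  refine Real.exp_le_exp.2 (le_of_eq ?_)
  simp only [Finset.sum_const, Finset.card_univ, Fintype.card_fin, nsmul_eq_mul]
  push_cast
  field_simp

/-- A weight that exceeds `2⁸ d / (2 ε₀)` if some deviation exceeds `d ≥ 2 ε₀`. -/
noncomputable def weight (hK : 0 < K) (ν : Fin K → ProbabilityMeasure ℝ) (ε : ℝ) (i : ℕ)
    (p : List Bool) (x : Fin T → Fin K → ℝ) : ℝ :=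
  -- For ε = ε₀, the slope 4 log 48 / ε optimises the Chernoff bound at deviation 2 ε; the factor
  -- exp (-8 log 48) normalises the exponential to 1 there.
  1 + ∑ j, 2 ^ 8 * Real.exp (-8 * Real.log 48) *
    (Real.exp (4 * Real.log 48 / ε * tableDev hK ν i p j x) +
      Real.exp (-(4 * Real.log 48 / ε) * tableDev hK ν i p j x))

lemma one_le_weight (ε : ℝ) (i : ℕ) (p : List Bool) (x : Fin T → Fin K → ℝ) :
    1 ≤ weight hK ν ε i p x := by
  unfold weight
  have : 0 ≤ ∑ j, 2 ^ 8 * Real.exp (-8 * Real.log 48) *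
    (Real.exp (4 * Real.log 48 / ε * tableDev hK ν i p j x) +
      Real.exp (-(4 * Real.log 48 / ε) * tableDev hK ν i p j x)) :=
    Finset.sum_nonneg fun j _ => by positivity
  linarith

lemma measurable_weight (ε : ℝ) (i : ℕ) (p : List Bool) :
    Measurable (weight (T := T) hK ν ε i p) := by
  unfold weight
  have := fun j => measurable_tableDev (T := T) (hK := hK) (ν := ν) i p j
  fun_prop

lemma one_le_log_48 : 1 ≤ Real.log 48 := by
  rw [Real.le_log_iff_exp_le (by norm_num)]
  have := Real.exp_one_lt_d9
  linarith

/-- With u = |d| / ε ≥ 2 and L = log 48, exp (4 L (u - 2)) ≥ 1 + 4 L (u - 2) ≥ u / 2: the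
exponential also pays for the size of the deviation. -/
lemma le_weight {ε : ℝ} (hε : 0 < ε) {i : ℕ} {p : List Bool} {j : Fin 3} {x : Fin T → Fin K → ℝ}
    (h : 2 * ε ≤ |tableDev hK ν i p j x|) :
    2 ^ 8 * (|tableDev hK ν i p j x| / (2 * ε)) ≤ weight hK ν ε i p x := by
  have hL := one_le_log_48
  set L := Real.log 48
  set d := tableDev hK ν i p j x with hd
  have h1 : Real.exp (4 * L / ε * |d|) ≤ Real.exp (4 * L / ε * d) + Real.exp (-(4 * L / ε) * d) := by
    rcases abs_choice d with h' | h' <;> rw [h']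
    · exact le_add_of_nonneg_right (Real.exp_pos _).le
    · rw [mul_neg, ← neg_mul]
      exact le_add_of_nonneg_left (Real.exp_pos _).le
  have h2 : |d| / (2 * ε) ≤ Real.exp (-8 * L) * Real.exp (4 * L / ε * |d|) := by
    rw [← Real.exp_add]
    refine le_trans ?_ (Real.add_one_le_exp _)
    have hu : 2 ≤ |d| / ε := by rwa [le_div_iff₀ hε]
    have e1 : |d| / (2 * ε) = (|d| / ε) / 2 := by field_simp
    have e2 : 4 * L / ε * |d| = 4 * L * (|d| / ε) := by field_simp
    rw [e1, e2]
    nlinarith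
  have h3 : 2 ^ 8 * Real.exp (-8 * L) * (Real.exp (4 * L / ε * d) + Real.exp (-(4 * L / ε) * d)) ≤
      weight hK ν ε i p x := by
    unfold weight
    refine le_trans ?_ (le_add_of_nonneg_left zero_le_one)
    exact Finset.single_le_sum (f := fun j => 2 ^ 8 * Real.exp (-8 * L) *
      (Real.exp (4 * L / ε * tableDev hK ν i p j x) +
        Real.exp (-(4 * L / ε) * tableDev hK ν i p j x))) (fun j _ => by positivity)
      (Finset.mem_univ j)
  refine le_trans ?_ h3
  rw [mul_assoc]
  refine mul_le_mul_of_nonneg_left (h2.trans ?_) (by norm_num)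
  exact mul_le_mul_of_nonneg_left h1 (Real.exp_pos _).le

lemma exp_mul_log_48 : Real.exp (4 * Real.log 48) = 48 ^ 4 := by
  rw [show (4 : ℝ) * Real.log 48 = ((4 : ℕ) : ℝ) * Real.log 48 by norm_num, ← Real.log_pow,
    Real.exp_log (by norm_num)]

lemma exp_neg_mul_log_48 : Real.exp (-8 * Real.log 48) = (48 ^ 8)⁻¹ := by
  rw [show (-8 : ℝ) * Real.log 48 = -(((8 : ℕ) : ℝ) * Real.log 48) by norm_num, Real.exp_neg,
    ← Real.log_pow, Real.exp_log (by norm_num)]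

/-- By the choice of ε₀ each exponential moment is at most 48⁴, so the mean is at most 1 + 3 · 2 ·
2⁸ · 48⁻⁴. -/
lemma lintegral_weight_le {σ : ℝ} (hσ : 0 < σ)
    (h : ∀ k, HasSubgaussianMGF (fun x => x - mean (ν k)) (⟨σ ^ 2, sq_nonneg σ⟩ : ℝ≥0)
      (ν k : Measure ℝ))
    (hT : 0 < T₂ K T) {i : ℕ} (hi : i < T₁ K) (p : List Bool) :
    ∫⁻ x, ENNReal.ofReal (weight hK ν (eps0 K T σ) i p x) ∂tableLaw T ν ≤
      ENNReal.ofReal (11 / 10) := by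
  have hpos : (0 : ℝ) < T₂ K T := by exact_mod_cast hT
  have hL := one_le_log_48
  set ε := eps0 K T σ with hε
  have hε2 : ε ^ 2 = 2 * σ ^ 2 * Real.log 48 / T₂ K T := Real.sq_sqrt (by positivity)
  have hexp : ∀ (t : ℝ), t ^ 2 = (4 * Real.log 48 / ε) ^ 2 → ∀ j,
      ∫⁻ x, ENNReal.ofReal (Real.exp (t * tableDev hK ν i p j x)) ∂tableLaw T ν ≤
      ENNReal.ofReal (48 ^ 4) := by
    intro t ht j
    refine (lintegral_exp_tableDev_le h hT hi p j t).trans (le_of_eq ?_)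
    rw [← exp_mul_log_48, ht, div_pow, hε2]
    congr 2
    change σ ^ 2 * _ / _ = _
    have : Real.log 48 ≠ 0 := by positivity
    field_simp
    norm_num
  have hm := fun j => measurable_tableDev (T := T) (hK := hK) (ν := ν) i p j
  have hw : ∀ x : Fin T → Fin K → ℝ, ENNReal.ofReal (weight hK ν ε i p x) =
      1 + ∑ j, ENNReal.ofReal (2 ^ 8 * Real.exp (-8 * Real.log 48)) *
        (ENNReal.ofReal (Real.exp (4 * Real.log 48 / ε * tableDev hK ν i p j x)) +
          ENNReal.ofReal (Real.exp (-(4 * Real.log 48 / ε) * tableDev hK ν i p j x))) := by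
    intro x
    unfold weight
    rw [ENNReal.ofReal_add zero_le_one (Finset.sum_nonneg fun j _ => by positivity),
      ENNReal.ofReal_one, ENNReal.ofReal_sum_of_nonneg fun j _ => by positivity]
    congr 1
    refine Finset.sum_congr rfl fun j _ => ?_
    rw [ENNReal.ofReal_mul (by positivity), ENNReal.ofReal_add (by positivity) (by positivity)]
  simp only [hw]
  rw [lintegral_add_left measurable_const, lintegral_finsetSum _ fun j _ => by fun_prop]
  calc _ ≤ 1 + ∑ j : Fin 3, ENNReal.ofReal (2 ^ 8 * Real.exp (-8 * Real.log 48)) *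
        (ENNReal.ofReal (48 ^ 4) + ENNReal.ofReal (48 ^ 4)) := by
        refine add_le_add (by simp) (Finset.sum_le_sum fun j _ => ?_)
        rw [lintegral_const_mul _ (by fun_prop), lintegral_add_left (by fun_prop)]
        gcongr
        · exact hexp _ rfl j
        · exact hexp _ (by ring) j
    _ ≤ ENNReal.ofReal (11 / 10) := by
        rw [exp_neg_mul_log_48, ← ENNReal.ofReal_add (by positivity) (by positivity),
          ← ENNReal.ofReal_mul (by positivity), Finset.sum_const, Finset.card_univ,
          Fintype.card_fin, ← ENNReal.ofReal_nsmul, ← ENNReal.ofReal_one,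
          ← ENNReal.ofReal_add (by norm_num) (by positivity)]
        refine ENNReal.ofReal_le_ofReal ?_
        norm_num

/-- The node of step n and the earlier weights depend on earlier rows of the table, the weight at a
fixed node on the rows of step n. So the last factor can be integrated first, with a bound uniform
in the node. -/
lemma lintegral_prod_weight_le {σ τ : ℝ} (hσ : 0 < σ) (s : (mtb K T hK τ σ).Seed)
    (h : ∀ k, HasSubgaussianMGF (fun x => x - mean (ν k)) (⟨σ ^ 2, sq_nonneg σ⟩ : ℝ≥0)
      (ν k : Measure ℝ)) (hT : 0 < T₂ K T) {n : ℕ} (hn : n ≤ T₁ K) :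
    ∫⁻ x, ∏ i ∈ Finset.range n, ENNReal.ofReal
      (weight hK ν (eps0 K T σ) i (node K T τ (observed hK τ σ s x) i) x) ∂tableLaw T ν ≤
      ENNReal.ofReal (11 / 10) ^ n := by
  have hobs : Measurable fun x : Fin T → Fin K → ℝ => observed hK τ σ s x :=
    measurable_observed.comp measurable_prodMk_left
  have hnode := fun i => (measurable_node K T τ i).comp hobs
  have hwm : ∀ i, Measurable fun x : Fin T → Fin K → ℝ => ENNReal.ofReal
      (weight hK ν (eps0 K T σ) i (node K T τ (observed hK τ σ s x) i) x) := by
    intro i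
    exact ((measurable_from_prod_countable_right (f := fun z : List Bool × (Fin T → Fin K → ℝ) =>
      weight hK ν (eps0 K T σ) i z.1 z.2) fun p => measurable_weight _ i p).comp
        ((hnode i).prodMk measurable_id)).ennreal_ofReal
  induction n with
  | zero => simp
  | succ n ih =>
    simp only [Finset.prod_range_succ]
    rw [pow_succ, mul_comm (_ ^ n)]
    refine le_trans ?_ (mul_le_mul_right (ih (by omega)) _)
    unfold tableLaw
    have hwcongr : ∀ i p {x x' : Fin T → Fin K → ℝ},
        (∀ m : Fin T, (m : ℕ) / (3 * T₂ K T) = i → x m = x' m) →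
        weight hK ν (eps0 K T σ) i p x = weight hK ν (eps0 K T σ) i p x' := by
      intro i p x x' hx
      unfold weight
      simp only [fun j => tableDev_congr (hK := hK) (ν := ν) p j hx]
    refine lintegral_mul_le_of_dependsOn
      (S := Finset.univ.filter fun m : Fin T => (m : ℕ) / (3 * T₂ K T) < n)
      (N := fun x => node K T τ (observed hK τ σ s x) n)
      (h := fun p x => ENNReal.ofReal (weight hK ν (eps0 K T σ) n p x))
      (hnode n) (Finset.measurable_prod _ fun i _ => hwm i)
      (fun p => (measurable_weight _ n p).ennreal_ofReal) ?_ ?_ ?_ ?_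
    · intro x x' hx
      exact node_observed_congr fun m hm => hx m (by simpa using hm)
    · intro x x' hx
      refine Finset.prod_congr rfl fun i hi => ?_
      have hi' := Finset.mem_range.1 hi
      rw [node_observed_congr (x' := x') fun m hm => hx m (by simpa using hm.trans hi'),
        hwcongr i _ fun m hm => hx m (by simpa using by omega)]
    · intro p x x' hx
      simp only
      rw [hwcongr n p fun m hm => hx m (by simp; omega)]
    · intro p
      exact lintegral_weight_le hσ h hT (by omega) p

end

end ThresholdBandit.MTB

namespace ThresholdBandit.MTB

/-! ### The regret of MTB -/

lemma one_le_log {K : ℕ} (hK : 3 ≤ K) : 1 ≤ Real.log K := by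
  rw [Real.le_log_iff_exp_le (by positivity)]
  have h1 := Real.exp_one_lt_d9
  have h2 : (3 : ℝ) ≤ K := by exact_mod_cast hK
  linarith

/-- As 6 log 2 > 4, T₁ is at least 4 ⌊log₂ K⌋, and ⌊log₂ K⌋ ≥ 1. -/
lemma two_mul_log_two_add_one_le {K : ℕ} (hK : 3 ≤ K) : 2 * (Nat.log 2 K + 1) ≤ T₁ K := by
  have h1 : 2 ^ Nat.log 2 K ≤ K := Nat.pow_log_le_self 2 (by omega)
  have h2 : 1 ≤ Nat.log 2 K := Nat.log_pos (by norm_num) (by omega)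
  have h3 : (Nat.log 2 K : ℝ) * Real.log 2 ≤ Real.log K := by
    rw [← Real.log_pow]
    exact Real.log_le_log (by positivity) (by exact_mod_cast h1)
  have h4 : (1 : ℝ) ≤ Nat.log 2 K := by exact_mod_cast h2
  have h5 := Real.log_two_gt_d9
  have h6 : 6 * Real.log K ≤ T₁ K := Nat.le_ceil _
  have h7 : (2 * (Nat.log 2 K + 1) : ℝ) ≤ T₁ K := by nlinarith
  exact_mod_cast h7

lemma T₁_le {K : ℕ} (hK : 3 ≤ K) : (T₁ K : ℝ) ≤ 7 * Real.log K := by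
  have h1 := one_le_log hK
  have h2 : (T₁ K : ℝ) < 6 * Real.log K + 1 := Nat.ceil_lt_add_one (by positivity)
  linarith

lemma log_48_le : Real.log 48 ≤ 3.9 := by
  rw [Real.log_le_iff_le_exp (by norm_num)]
  have h1 : Real.exp 3.9 = Real.exp 1 ^ 4 * Real.exp (-0.1) := by
    rw [← Real.exp_nat_mul, ← Real.exp_add]
    norm_num
  have h2 := Real.exp_one_gt_d9
  have h3 := Real.add_one_le_exp (-0.1 : ℝ)
  have h4 : (2.718 : ℝ) ^ 4 ≤ Real.exp 1 ^ 4 := pow_le_pow_left₀ (by norm_num) (by linarith) 4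
  rw [h1]
  calc (48 : ℝ) ≤ 2.718 ^ 4 * (-0.1 + 1) := by norm_num
    _ ≤ _ := mul_le_mul h4 h3 (by norm_num) (by positivity)

/-- Rounding in T₂ ≥ 1 costs at most a factor 2, so T ≤ 6 T₁ T₂ ≤ 42 T₂ log K. The constant 80 is
sufficient because 2 · 3.9 · 42 = 327.6 ≤ (80 / 4.4)². -/
lemma eps0_le {K T : ℕ} (hK : 3 ≤ K) (hT : 0 < T₂ K T) (σ : ℝ) :
    4.4 * eps0 K T σ ≤ 80 * √(σ ^ 2 * Real.log K / T) := by
  have h1 : T < T₂ K T * (3 * T₁ K) + 3 * T₁ K := by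
    have := Nat.div_add_mod T (3 * T₁ K)
    have h2 : 0 < 3 * T₁ K := by have := two_mul_log_two_add_one_le hK; omega
    have h3 := Nat.mod_lt T h2
    rw [mul_comm] at this
    change T / (3 * T₁ K) * (3 * T₁ K) + _ = T at this
    unfold T₂
    omega
  have h2 : T ≤ 6 * (T₁ K * T₂ K T) := by nlinarith
  have h3 : (T : ℝ) ≤ 6 * (T₁ K * T₂ K T) := by exact_mod_cast h2
  have hT0 : 0 < T := by
    by_contra h
    have : T = 0 := by omega
    simp [T₂, this] at hT
  have hT' : (0 : ℝ) < T := by exact_mod_cast hT0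
  have hT₂ : (0 : ℝ) < T₂ K T := by exact_mod_cast hT
  have h4 := T₁_le hK
  have h5 := log_48_le
  have h6 := one_le_log_48
  have h7 := one_le_log hK
  have h8 : (T : ℝ) ≤ 42 * Real.log K * T₂ K T := by nlinarith
  have h9 : 2 * σ ^ 2 * Real.log 48 / T₂ K T ≤ (80 / 4.4) ^ 2 * (σ ^ 2 * Real.log K / T) := by
    rw [← mul_div_assoc, div_le_div_iff₀ hT₂ hT']
    have h10 : 2 * Real.log 48 * T ≤ (80 / 4.4) ^ 2 * Real.log K * T₂ K T := by
      calc 2 * Real.log 48 * T ≤ 2 * 3.9 * (42 * Real.log K * T₂ K T) := by gcongr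
        _ = 327.6 * (Real.log K * T₂ K T) := by ring
        _ ≤ (80 / 4.4) ^ 2 * (Real.log K * T₂ K T) := by gcongr; norm_num
        _ = _ := by ring
    nlinarith [mul_le_mul_of_nonneg_left h10 (sq_nonneg σ)]
  have h10 : eps0 K T σ ≤ 80 / 4.4 * √(σ ^ 2 * Real.log K / T) := by
    unfold eps0
    refine (Real.sqrt_le_sqrt h9).trans (le_of_eq ?_)
    rw [Real.sqrt_mul (by positivity), Real.sqrt_sq (by norm_num)]
  calc 4.4 * eps0 K T σ ≤ 4.4 * (80 / 4.4 * √(σ ^ 2 * Real.log K / T)) := by gcongr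
    _ = _ := by ring

section

variable {K T : ℕ} {hK : 0 < K} {τ σ : ℝ} {ν : Fin K → ProbabilityMeasure ℝ}

open Classical in
-- Since D ≤ T₁ / 2, at least T₁ / 8 steps are bad. Each contributes a factor 2⁸, together 2 ^ T₁,
-- and the step with the largest deviation, taken as `e`, contributes e / (2 ε₀) in addition.
lemma pow_le_prod_weight (hK3 : 3 ≤ K) (hε : 0 < eps0 K T σ)
    (s : (mtb K T hK τ σ).Seed) (x : Fin T → Fin K → ℝ)
    (hbad : T₁ K ≤ 4 * (Finset.univ.filter fun i : Fin (T₁ K) =>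
      ¬Accurate K T τ (armMean hK ν) (observed hK τ σ s x) (2 * eps0 K T σ) i).card +
      (Nat.log 2 K + 1)) :
    ∃ e, 2 * eps0 K T σ ≤ e ∧
      (∀ i : Fin (T₁ K), Accurate K T τ (armMean hK ν) (observed hK τ σ s x) e i) ∧
      2 ^ T₁ K * (e / (2 * eps0 K T σ)) ≤ ∏ i ∈ Finset.range (T₁ K),
        weight hK ν (eps0 K T σ) i (node K T τ (observed hK τ σ s x) i) x := by
  set ε := eps0 K T σ with hεdef
  set bad := Finset.univ.filter fun i : Fin (T₁ K) =>
      ¬Accurate K T τ (armMean hK ν) (observed hK τ σ s x) (2 * ε) i with hbaddef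
  have hD := two_mul_log_two_add_one_le hK3
  have hcard : T₁ K ≤ 8 * bad.card := by omega
  set d : Fin (T₁ K) → Fin 3 → ℝ := fun i j =>
    |tableDev hK ν i (node K T τ (observed hK τ σ s x) i) j x| with hd
  have hacc : ∀ e (i : Fin (T₁ K)), Accurate K T τ (armMean hK ν) (observed hK τ σ s x) e i ↔
      ∀ j, d i j ≤ e := by
    intro e i
    unfold Accurate
    simp only [dev_observed]
    rfl
  have hne : Nonempty (Fin (T₁ K)) := ⟨⟨0, by omega⟩⟩
  obtain ⟨⟨i₀, j₀⟩, hmax⟩ := Finite.exists_max fun q : Fin (T₁ K) × Fin 3 => d q.1 q.2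
  have hbadj : ∀ i ∈ bad, ∃ j, 2 * ε < d i j := by
    intro i hi
    have := (Finset.mem_filter.1 hi).2
    rw [hacc] at this
    push Not at this
    exact this
  have hpos : 0 < bad.card := by omega
  have he : 2 * ε < d i₀ j₀ := by
    obtain ⟨i, hi⟩ := Finset.card_pos.1 hpos
    obtain ⟨j, hj⟩ := hbadj i hi
    exact hj.trans_le (hmax (i, j))
  have hi₀ : i₀ ∈ bad := by
    rw [hbaddef, Finset.mem_filter]
    refine ⟨Finset.mem_univ _, fun h => ?_⟩
    exact absurd ((hacc _ _).1 h j₀) (not_le.2 he)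
  refine ⟨d i₀ j₀, he.le, fun i => (hacc _ _).2 fun j => hmax (i, j), ?_⟩
  set w : Fin (T₁ K) → ℝ := fun i =>
    weight hK ν ε i (node K T τ (observed hK τ σ s x) i) x with hw
  have hw1 : ∀ i, 1 ≤ w i := fun i => one_le_weight _ _ _ _
  have hwbad : ∀ i ∈ bad, 2 ^ 8 ≤ w i := by
    intro i hi
    obtain ⟨j, hj⟩ := hbadj i hi
    refine le_trans ?_ (le_weight hε hj.le)
    have : 1 ≤ d i j / (2 * ε) := by rw [le_div_iff₀ (by positivity)]; linarith
    change (2 : ℝ) ^ 8 ≤ 2 ^ 8 * (d i j / (2 * ε))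
    linarith
  have hw0 : 2 ^ 8 * (d i₀ j₀ / (2 * ε)) ≤ w i₀ := le_weight hε he.le
  have hprod : ∏ i ∈ Finset.range (T₁ K),
      weight hK ν ε i (node K T τ (observed hK τ σ s x) i) x = ∏ i, w i := by
    rw [Finset.prod_range]
  rw [hprod]
  have hd0 : 0 ≤ d i₀ j₀ / (2 * ε) := div_nonneg (abs_nonneg _) (by positivity)
  calc 2 ^ T₁ K * (d i₀ j₀ / (2 * ε))
      ≤ 2 ^ (8 * bad.card) * (d i₀ j₀ / (2 * ε)) := by
        gcongr
        norm_num
    _ = (2 ^ 8) ^ (bad.erase i₀).card * (2 ^ 8 * (d i₀ j₀ / (2 * ε))) := by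
        rw [← Finset.card_erase_add_one hi₀, pow_mul, pow_succ]
        ring
    _ ≤ (∏ i ∈ bad.erase i₀, w i) * w i₀ := by
        refine mul_le_mul ?_ hw0 (by positivity)
          (Finset.prod_nonneg fun i _ => zero_le_one.trans (hw1 i))
        rw [← Finset.prod_const]
        exact Finset.prod_le_prod (fun _ _ => by norm_num) fun i hi =>
          hwbad i (Finset.mem_of_mem_erase hi)
    _ = ∏ i ∈ bad, w i := Finset.prod_erase_mul _ _ hi₀
    _ ≤ ∏ i, w i := Finset.prod_le_prod_of_subset_of_one_le (Finset.subset_univ _)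
        (fun i _ => zero_le_one.trans (hw1 i)) fun i _ _ => hw1 i

/-- The summand 1 pays for the good case; in the bad case the regret 2 e = 4 ε₀ · e / (2 ε₀) is paid
for by the product. -/
lemma regret_mtb_le (hK3 : 3 ≤ K) (hν : Monotone fun k => mean (ν k)) (hε : 0 < eps0 K T σ)
    (s : (mtb K T hK τ σ).Seed) (x : Fin T → Fin K → ℝ) :
    regret τ ν ((mtb K T hK τ σ).guess (s, (mtb K T hK τ σ).rewards s x T le_rfl)) ≤
      ENNReal.ofReal (4 * eps0 K T σ) * (1 + (ENNReal.ofReal (1 / 2)) ^ T₁ K *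
        ∏ i ∈ Finset.range (T₁ K), ENNReal.ofReal
          (weight hK ν (eps0 K T σ) i (node K T τ (observed hK τ σ s x) i) x)) := by
  classical
  have hD := two_mul_log_two_add_one_le hK3
  have hμ := armMean_mono hK hν
  change regret τ ν (fun k => decide (chosen K T τ σ s (observed hK τ σ s x) ≤ (k : ℕ) + 1)) ≤ _
  by_cases hbad : 4 * (Finset.univ.filter fun i : Fin (T₁ K) =>
      ¬Accurate K T τ (armMean hK ν) (observed hK τ σ s x) (2 * eps0 K T σ) i).card +
      (Nat.log 2 K + 1) < T₁ K
  · refine ((chosen_acceptable hμ hbad s).regret_le hν (armMean_succ hK ν)).trans ?_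
    exact le_mul_of_one_le_right' le_self_add
  · obtain ⟨e, he, hacc, hprod⟩ := pow_le_prod_weight hK3 hε s x (not_lt.1 hbad)
    refine ((chosen_acceptable_of_forall (by omega) (by omega) hμ he hacc s).regret_le hν
      (armMean_succ hK ν)).trans ?_
    rw [← ENNReal.ofReal_prod_of_nonneg fun i _ => zero_le_one.trans (one_le_weight _ _ _ _),
      ← ENNReal.ofReal_pow (by norm_num), ← ENNReal.ofReal_mul (by positivity)]
    refine le_trans ?_ (mul_le_mul_right le_add_self _)
    rw [← ENNReal.ofReal_mul (by positivity)]
    refine ENNReal.ofReal_le_ofReal ?_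
    have h1 : (1 / 2 : ℝ) ^ T₁ K * (2 ^ T₁ K * (e / (2 * eps0 K T σ))) = e / (2 * eps0 K T σ) := by
      rw [← mul_assoc, ← mul_pow]
      norm_num
    calc 2 * e = 4 * eps0 K T σ * (e / (2 * eps0 K T σ)) := by field_simp; ring
      _ = 4 * eps0 K T σ * ((1 / 2 : ℝ) ^ T₁ K * (2 ^ T₁ K * (e / (2 * eps0 K T σ)))) := by rw [h1]
      _ ≤ _ := by gcongr

/-- The upper bound for MTB on sub-Gaussian problems. -/
lemma worstRegret_mtb_le (hK3 : 3 ≤ K) (hσ : 0 < σ) (hT : 0 < T₂ K T) :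
    worstRegret τ (subGaussianMonotone K σ) (mtb K T hK τ σ) ≤
      ENNReal.ofReal (80 * √(σ ^ 2 * Real.log K / T)) := by
  refine iSup₂_le fun ν hν => ?_
  have hT₁ := two_mul_log_two_add_one_le hK3
  have hlog : 1 ≤ Nat.log 2 K := Nat.log_pos (by norm_num) (by omega)
  have hL := one_le_log_48
  have hε : 0 < eps0 K T σ := by
    have : (0 : ℝ) < T₂ K T := by exact_mod_cast hT
    unfold eps0
    positivity
  have hwm : ∀ i, Measurable fun z : (mtb K T hK τ σ).Seed × (Fin T → Fin K → ℝ) =>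
      ENNReal.ofReal (weight hK ν (eps0 K T σ) i (node K T τ (observed hK τ σ z.1 z.2) i) z.2) := by
    intro i
    exact ((measurable_from_prod_countable_right (f := fun z : List Bool × (Fin T → Fin K → ℝ) =>
      weight hK ν (eps0 K T σ) i z.1 z.2) fun p => measurable_weight _ i p).comp
        (((measurable_node K T τ i).comp measurable_observed).prodMk measurable_snd)).ennreal_ofReal
  have hPm := Finset.measurable_prod (Finset.range (T₁ K)) fun i _ => hwm i
  have hprod : ∫⁻ z, ∏ i ∈ Finset.range (T₁ K), ENNReal.ofReal
      (weight hK ν (eps0 K T σ) i (node K T τ (observed hK τ σ z.1 z.2) i) z.2)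
      ∂((mtb K T hK τ σ).law.prod (tableLaw T ν)) ≤ ENNReal.ofReal (11 / 10) ^ T₁ K := by
    rw [lintegral_prod _ hPm.aemeasurable]
    calc _ ≤ ∫⁻ _, ENNReal.ofReal (11 / 10) ^ T₁ K ∂(mtb K T hK τ σ).law :=
          lintegral_mono fun s => lintegral_prod_weight_le hσ s hν.1 hT le_rfl
      _ = _ := by simp
  unfold expRegret
  calc _ ≤ ∫⁻ z, ENNReal.ofReal (4 * eps0 K T σ) * (1 + (ENNReal.ofReal (1 / 2)) ^ T₁ K *
        ∏ i ∈ Finset.range (T₁ K), ENNReal.ofReal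
          (weight hK ν (eps0 K T σ) i (node K T τ (observed hK τ σ z.1 z.2) i) z.2))
          ∂((mtb K T hK τ σ).law.prod (tableLaw T ν)) :=
        lintegral_mono fun z => regret_mtb_le hK3 hν.2 hε z.1 z.2
    _ ≤ ENNReal.ofReal (4 * eps0 K T σ) * (1 + (ENNReal.ofReal (1 / 2)) ^ T₁ K *
        ENNReal.ofReal (11 / 10) ^ T₁ K) := by
        rw [lintegral_const_mul _ ((hPm.const_mul _).const_add _),
          lintegral_add_left measurable_const, lintegral_const_mul _ hPm]
        gcongr
        simp
    _ ≤ ENNReal.ofReal (4.4 * eps0 K T σ) := by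
        rw [← mul_pow, ← ENNReal.ofReal_mul (by norm_num), ← ENNReal.ofReal_pow (by norm_num),
          ← ENNReal.ofReal_one, ← ENNReal.ofReal_add (by norm_num) (by positivity),
          ← ENNReal.ofReal_mul (by positivity)]
        refine ENNReal.ofReal_le_ofReal ?_
        -- T₁ ≥ 4, and 0.55⁴ < 0.1.
        have h1 : (1 / 2 * (11 / 10) : ℝ) ^ T₁ K ≤ (1 / 2 * (11 / 10)) ^ 4 :=
          pow_le_pow_of_le_one (by norm_num) (by norm_num) (by omega)
        have h2 : (1 / 2 * (11 / 10) : ℝ) ^ T₁ K ≤ 0.1 := h1.trans (by norm_num)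
        nlinarith
    _ ≤ _ := ENNReal.ofReal_le_ofReal (eps0_le hK3 hT σ)

lemma regret_le_of_mem_Icc {r : ℝ} (h : ∀ k, |τ - mean (ν k)| ≤ r) (q : Fin K → Bool) :
    regret τ ν q ≤ ENNReal.ofReal r :=
  iSup₂_le fun k _ => ENNReal.ofReal_le_ofReal (h k)

end

end ThresholdBandit.MTB

/-! ### Bounded rewards: Hoeffding's lemma and the case T₂ = 0 -/

namespace ThresholdBandit

lemma mean_mem_Icc {P : ProbabilityMeasure ℝ} {a b : ℝ}
    (h : ∀ᵐ x ∂(P : Measure ℝ), x ∈ Set.Icc a b) : mean P ∈ Set.Icc a b := by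
  have hint : Integrable (fun x : ℝ => x) (P : Measure ℝ) :=
    Integrable.of_mem_Icc a b aemeasurable_id h
  constructor
  · have := integral_mono_ae (integrable_const a) hint (h.mono fun x hx => hx.1)
    simpa [mean] using this
  · have := integral_mono_ae hint (integrable_const b) (h.mono fun x hx => hx.2)
    simpa [mean] using this

/-- Hoeffding's lemma: a law supported in an interval of length at most `2 σ` is
`σ²`-sub-Gaussian. -/
lemma hasSubgaussianMGF_of_support {P : ProbabilityMeasure ℝ} {a b σ : ℝ} (hab : |b - a| ≤ 2 * σ)
    (h : ∀ᵐ x ∂(P : Measure ℝ), x ∈ Set.Icc a b) :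
    HasSubgaussianMGF (fun x => x - mean P) (⟨σ ^ 2, sq_nonneg σ⟩ : ℝ≥0) (P : Measure ℝ) := by
  have h1 := hasSubgaussianMGF_of_mem_Icc (X := fun x : ℝ => x) (μ := (P : Measure ℝ))
    aemeasurable_id h
  refine ⟨h1.integrable_exp_mul, fun t => (h1.mgf_le t).trans (Real.exp_le_exp.2 ?_)⟩
  have h2 : (((‖b - a‖₊ / 2) ^ 2 : ℝ≥0) : ℝ) ≤ σ ^ 2 := by
    push_cast
    rw [Real.norm_eq_abs]
    have := abs_nonneg (b - a)
    exact pow_le_pow_left₀ (by positivity) (by linarith) 2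
  change _ ≤ σ ^ 2 * t ^ 2 / 2
  gcongr

lemma boundedMonotone_subset (K : ℕ) : boundedMonotone K ⊆ subGaussianMonotone K 1 :=
  fun _ hν => ⟨fun k => hasSubgaussianMGF_of_support (a := 0) (b := 1) (by norm_num) (hν.1 k), hν.2⟩

/-- The upper bound for MTB on problems with support in `[0,1]`. -/
lemma worstRegret_mtb_boundedMonotone_le {K T : ℕ} {hK : 0 < K} (hK3 : 3 ≤ K) {τ : ℝ}
    (hτ : τ ∈ Set.Ioo (0 : ℝ) 1) (hT : 12 * Real.log K ≤ T) :
    worstRegret τ (boundedMonotone K) (mtb K T hK τ 1) ≤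
      ENNReal.ofReal (80 * √(Real.log K / T)) := by
  rcases Nat.eq_zero_or_pos (MTB.T₂ K T) with h0 | hpos
  · have hlog := MTB.one_le_log hK3
    have hT₁ := MTB.T₁_le hK3
    have hTpos : (0 : ℝ) < T := by linarith
    have h1 : T < 3 * MTB.T₁ K := by
      by_contra h
      have h2 : 0 < 3 * MTB.T₁ K := by have := MTB.two_mul_log_two_add_one_le hK3; omega
      have := Nat.div_pos (not_lt.1 h) h2
      unfold MTB.T₂ at h0
      omega
    have h2 : (T : ℝ) ≤ 3 * MTB.T₁ K := by exact_mod_cast h1.le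
    -- With T ≤ 3 T₁ ≤ 21 log K the claimed bound is at least 1, which the regret never exceeds on
    -- [0,1].
    have h3 : (1 / 80 : ℝ) ≤ √(Real.log K / T) := by
      apply Real.le_sqrt_of_sq_le
      rw [le_div_iff₀ hTpos]
      nlinarith
    refine iSup₂_le fun ν hν => ?_
    calc expRegret τ ν (mtb K T hK τ 1) ≤ ∫⁻ _, ENNReal.ofReal 1
          ∂((mtb K T hK τ 1).law.prod (tableLaw T ν)) := by
          refine lintegral_mono fun z => MTB.regret_le_of_mem_Icc (fun k => ?_) _
          have := mean_mem_Icc (hν.1 k)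
          rw [abs_le]
          constructor <;> linarith [this.1, this.2, hτ.1, hτ.2]
      _ = ENNReal.ofReal 1 := by simp
      _ ≤ _ := ENNReal.ofReal_le_ofReal (by linarith)
  · have := MTB.worstRegret_mtb_le (hK := hK) (τ := τ) hK3 one_pos hpos
    rw [one_pow, one_mul] at this
    exact (biSup_mono (boundedMonotone_subset K)).trans this

end ThresholdBandit

namespace ThresholdBandit

/-! ### Change of measure -/

namespace Strategy

variable {K T : ℕ} (π : Strategy K T)

lemma measurable_snoc {t : ℕ} :
    Measurable fun z : (Fin t → ℝ) × ℝ => (Fin.snoc (α := fun _ => ℝ) z.1 z.2 : Fin (t + 1) → ℝ) := by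
  refine measurable_pi_lambda _ fun i => ?_
  induction i using Fin.lastCases with
  | last => simpa using measurable_snd
  | cast i => simpa using measurable_fst.eval

lemma measurable_pull_mk (s : π.Seed) (t : Fin T) : Measurable fun h => π.pull t (s, h) :=
  (π.measurable_pull t).comp measurable_prodMk_left

lemma measurable_rewards_mk (s : π.Seed) {t : ℕ} (ht : t ≤ T) :
    Measurable fun x => π.rewards s x t ht :=
  (π.measurable_rewards ht).comp measurable_prodMk_left

/-- The expectation of a function of the next reward, given the past. -/
noncomputable def nextExp (ν : Fin K → ProbabilityMeasure ℝ) (s : π.Seed) {t : ℕ} (ht : t < T)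
    (F : (Fin (t + 1) → ℝ) → ℝ≥0∞) (h : Fin t → ℝ) : ℝ≥0∞ :=
  ∫⁻ y, F (Fin.snoc (α := fun _ => ℝ) h y) ∂(ν (π.pull ⟨t, ht⟩ (s, h)) : Measure ℝ)

lemma measurable_nextExp (ν : Fin K → ProbabilityMeasure ℝ) (s : π.Seed) {t : ℕ} (ht : t < T)
    {F : (Fin (t + 1) → ℝ) → ℝ≥0∞} (hF : Measurable F) : Measurable (π.nextExp ν s ht F) := by
  have h1 : ∀ k, Measurable fun h : Fin t → ℝ =>
      ∫⁻ y, F (Fin.snoc (α := fun _ => ℝ) h y) ∂(ν k : Measure ℝ) := fun k =>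
    (hF.comp measurable_snoc).lintegral_prod_right'
  exact (measurable_from_prod_countable_right (f := fun z : Fin K × (Fin t → ℝ) =>
    ∫⁻ y, F (Fin.snoc (α := fun _ => ℝ) z.2 y) ∂(ν z.1 : Measure ℝ)) h1).comp
      ((π.measurable_pull_mk s ⟨t, ht⟩).prodMk measurable_id)

/-- The past does not depend on row `t` of the table, so integrating out that row leaves the
conditional expectation given the past. -/
lemma lintegral_rewards_succ (ν : Fin K → ProbabilityMeasure ℝ) (s : π.Seed) {t : ℕ} (ht : t < T)
    {F : (Fin (t + 1) → ℝ) → ℝ≥0∞} (hF : Measurable F) :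
    ∫⁻ x, F (π.rewards s x (t + 1) ht) ∂tableLaw T ν =
      ∫⁻ x, π.nextExp ν s ht F (π.rewards s x t ht.le) ∂tableLaw T ν := by
  unfold tableLaw
  refine lintegral_eq_of_lmarginal_eq {⟨t, ht⟩} (hF.comp (π.measurable_rewards_mk s _))
    ((π.measurable_nextExp ν s ht hF).comp (π.measurable_rewards_mk s _)) ?_
  funext x
  rw [lmarginal_singleton, lmarginal_singleton]
  have hupd : ∀ r, π.rewards s (Function.update x ⟨t, ht⟩ r) t ht.le = π.rewards s x t ht.le := by
    intro r
    refine π.rewards_congr s ht.le fun i hi => ?_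
    rw [Function.update_of_ne]
    rintro rfl
    exact lt_irrefl _ hi
  simp only [rewards, hupd, Function.update_self, lintegral_const, measure_univ, mul_one]
  unfold nextExp
  set k := π.pull ⟨t, ht⟩ (s, π.rewards s x t ht.le)
  have hmp := measurePreserving_eval (fun k : Fin K => (ν k : Measure ℝ)) k
  have hFm : Measurable fun y => F (Fin.snoc (α := fun _ => ℝ) (π.rewards s x t ht.le) y) :=
    hF.comp (measurable_snoc.comp measurable_prodMk_left)
  rw [← hmp.lintegral_comp hFm]

/-- The likelihood of the rewards, if the law of arm `k` has density `g k`. -/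
noncomputable def likelihood {K T : ℕ} (π : Strategy K T) (g : Fin K → ℝ → ℝ≥0∞) (s : π.Seed) :
    (t : ℕ) → t ≤ T → (Fin t → ℝ) → ℝ≥0∞
  | 0, _, _ => 1
  | t + 1, ht, h => π.likelihood g s t (Nat.le_of_succ_le ht) (Fin.init h) *
      g (π.pull ⟨t, ht⟩ (s, Fin.init h)) (h (Fin.last t))

variable {g : Fin K → ℝ → ℝ≥0∞}

lemma measurable_likelihood (hg : ∀ k, Measurable (g k)) (s : π.Seed) {t : ℕ} (ht : t ≤ T) :
    Measurable (π.likelihood g s t ht) := by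
  induction t with
  | zero => exact measurable_const
  | succ t ih =>
    have hinit : Measurable fun h : Fin (t + 1) → ℝ => (Fin.init h : Fin t → ℝ) :=
      measurable_pi_lambda _ fun i => measurable_pi_apply _
    have hlast : Measurable fun h : Fin (t + 1) → ℝ =>
        g (π.pull ⟨t, ht⟩ (s, Fin.init h)) (h (Fin.last t)) :=
      (measurable_from_prod_countable_right (f := fun z : Fin K × ℝ => g z.1 z.2) hg).comp
        (((π.measurable_pull_mk s ⟨t, ht⟩).comp hinit).prodMk (measurable_pi_apply _))
    exact ((ih (Nat.le_of_succ_le ht)).comp hinit).mul hlast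

/-- The last round is conditioned out under both laws. Both use the same pull rule, so they differ
only by the density of the arm pulled. -/
lemma lintegral_rewards_eq (hg : ∀ k, Measurable (g k)) {ν ν' : Fin K → ProbabilityMeasure ℝ}
    (h : ∀ k, (ν' k : Measure ℝ) = (ν k : Measure ℝ).withDensity (g k)) (s : π.Seed) {t : ℕ}
    (ht : t ≤ T) {F : (Fin t → ℝ) → ℝ≥0∞} (hF : Measurable F) :
    ∫⁻ x, F (π.rewards s x t ht) ∂tableLaw T ν' =
      ∫⁻ x, π.likelihood g s t ht (π.rewards s x t ht) * F (π.rewards s x t ht) ∂tableLaw T ν := by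
  induction t with
  | zero => simp [rewards, likelihood]
  | succ t ih =>
    have hFL := (π.measurable_likelihood hg s ht).mul hF
    rw [π.lintegral_rewards_succ ν' s ht hF, ih _ (π.measurable_nextExp ν' s ht hF)]
    refine Eq.trans ?_ (π.lintegral_rewards_succ ν s ht hFL).symm
    refine lintegral_congr fun x => ?_
    have hFm : Measurable fun y => F (Fin.snoc (α := fun _ => ℝ) (π.rewards s x t (Nat.le_of_succ_le ht)) y) :=
      hF.comp (measurable_snoc.comp measurable_prodMk_left)
    simp only [nextExp, likelihood, Pi.mul_apply, Fin.init_snoc, Fin.snoc_last]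
    rw [h, lintegral_withDensity_eq_lintegral_mul _ (hg _) hFm]
    simp only [Pi.mul_apply, mul_assoc]
    exact (lintegral_const_mul _ ((hg _).mul hFm)).symm

/-- Each round multiplies the second moment by at most `V`, whichever arm is pulled, so adaptivity
does not help. -/
lemma lintegral_likelihood_sq_le (hg : ∀ k, Measurable (g k)) {ν : Fin K → ProbabilityMeasure ℝ}
    {V : ℝ≥0∞} (hV : ∀ k, ∫⁻ y, g k y ^ 2 ∂(ν k : Measure ℝ) ≤ V) (s : π.Seed) {t : ℕ}
    (ht : t ≤ T) :
    ∫⁻ x, π.likelihood g s t ht (π.rewards s x t ht) ^ 2 ∂tableLaw T ν ≤ V ^ t := by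
  induction t with
  | zero => simp [likelihood]
  | succ t ih =>
    have hL := (π.measurable_likelihood hg s ht).pow_const 2
    have hL' := ((π.measurable_likelihood hg s (Nat.le_of_succ_le ht)).pow_const 2).comp
      (π.measurable_rewards_mk s (Nat.le_of_succ_le ht))
    rw [π.lintegral_rewards_succ ν s ht hL, pow_succ]
    refine le_trans ?_ (mul_le_mul_left (ih (Nat.le_of_succ_le ht)) _)
    refine le_trans ?_ (lintegral_mul_const V hL').le
    refine lintegral_mono fun x => ?_
    simp only [nextExp, likelihood, Fin.init_snoc, Fin.snoc_last, mul_pow]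
    rw [lintegral_const_mul _ ((hg _).pow_const 2)]
    exact mul_le_mul_right (hV _) _

end Strategy

/-! ### Two-point laws -/

/-- The law on `{a, b}` with mean `m ∈ [a, b]`. -/
noncomputable def twoPoint (a b m : ℝ) : Measure ℝ :=
  ENNReal.ofReal ((b - m) / (b - a)) • Measure.dirac a +
    ENNReal.ofReal ((m - a) / (b - a)) • Measure.dirac b

section TwoPoint

variable {a b m : ℝ}

lemma lintegral_twoPoint (f : ℝ → ℝ≥0∞) : ∫⁻ x, f x ∂twoPoint a b m =
    ENNReal.ofReal ((b - m) / (b - a)) * f a + ENNReal.ofReal ((m - a) / (b - a)) * f b := by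
  simp [twoPoint, lintegral_add_measure, lintegral_smul_measure]

lemma isProbabilityMeasure_twoPoint (hab : a < b) (ham : a ≤ m) (hmb : m ≤ b) :
    IsProbabilityMeasure (twoPoint a b m) := by
  constructor
  have h : 0 < b - a := by linarith
  rw [← lintegral_one, lintegral_twoPoint, mul_one, mul_one, ← ENNReal.ofReal_add
    (div_nonneg (by linarith) h.le) (div_nonneg (by linarith) h.le), ← ENNReal.ofReal_one]
  congr 1
  field_simp
  ring

lemma ae_twoPoint (hab : a ≤ b) : ∀ᵐ x ∂twoPoint a b m, x ∈ Set.Icc a b := by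
  unfold twoPoint
  rw [ae_add_measure_iff]
  constructor
  · refine Measure.ae_smul_measure ?_ _
    rw [ae_dirac_eq]
    exact Set.left_mem_Icc.2 hab
  · refine Measure.ae_smul_measure ?_ _
    rw [ae_dirac_eq]
    exact Set.right_mem_Icc.2 hab

lemma integral_twoPoint (hab : a < b) (ham : a ≤ m) (hmb : m ≤ b) :
    ∫ x, x ∂twoPoint a b m = m := by
  have h : 0 < b - a := by linarith
  have h1 : ∀ (c : ℝ) (z : ℝ), Integrable (fun x : ℝ => x) (ENNReal.ofReal c • Measure.dirac z) :=
    fun c z => (integrable_dirac (by simp)).smul_measure ENNReal.ofReal_ne_top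
  rw [twoPoint, integral_add_measure (h1 _ _) (h1 _ _), integral_smul_measure,
    integral_smul_measure, integral_dirac, integral_dirac,
    ENNReal.toReal_ofReal (div_nonneg (by linarith) h.le),
    ENNReal.toReal_ofReal (div_nonneg (by linarith) h.le)]
  simp only [smul_eq_mul]
  field_simp
  ring

/-- The density of `twoPoint a b (τ + d)` with respect to `twoPoint a b τ`. -/
noncomputable def twoPointDensity (a b τ d x : ℝ) : ℝ≥0∞ :=
  ENNReal.ofReal (1 + d * (x - τ) / ((τ - a) * (b - τ)))

lemma measurable_twoPointDensity (a b τ d : ℝ) : Measurable (twoPointDensity a b τ d) := by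
  unfold twoPointDensity
  fun_prop

variable {τ d : ℝ}

/-- No bound on `d` is needed: the new masses are positive multiples of the density, so
`ENNReal.ofReal` truncates both at the same point. -/
lemma twoPoint_eq_withDensity (haτ : a < τ) (hτb : τ < b) :
    twoPoint a b (τ + d) = (twoPoint a b τ).withDensity (twoPointDensity a b τ d) := by
  have h : 0 < b - a := by linarith
  have h1 : 0 < τ - a := by linarith
  have h2 : 0 < b - τ := by linarith
  ext S hS
  rw [withDensity_apply _ hS, ← lintegral_indicator hS, lintegral_twoPoint,
    ← lintegral_indicator_one hS, lintegral_twoPoint]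
  have ea : ENNReal.ofReal ((b - (τ + d)) / (b - a)) =
      ENNReal.ofReal ((b - τ) / (b - a)) * twoPointDensity a b τ d a := by
    rw [twoPointDensity, ← ENNReal.ofReal_mul (by positivity)]
    congr 1
    field_simp
    ring
  have eb : ENNReal.ofReal ((τ + d - a) / (b - a)) =
      ENNReal.ofReal ((τ - a) / (b - a)) * twoPointDensity a b τ d b := by
    rw [twoPointDensity, ← ENNReal.ofReal_mul (by positivity)]
    congr 1
    field_simp
    ring
  rw [ea, eb]
  simp only [Set.indicator, Pi.one_apply]
  split_ifs <;> simp

/-- The density is 1 + d (x - τ) / v with v = (τ - a) (b - τ) the variance of the base law. The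
bounds on `d` keep it nonnegative, so nothing is truncated. -/
lemma lintegral_twoPointDensity_sq (haτ : a < τ) (hτb : τ < b) (ha : a ≤ τ + d) (hb : τ + d ≤ b) :
    ∫⁻ x, twoPointDensity a b τ d x ^ 2 ∂twoPoint a b τ =
      ENNReal.ofReal (1 + d ^ 2 / ((τ - a) * (b - τ))) := by
  have h : 0 < b - a := by linarith
  have h1 : 0 < τ - a := by linarith
  have h2 : 0 < b - τ := by linarith
  have ea : 1 + d * (a - τ) / ((τ - a) * (b - τ)) = (b - (τ + d)) / (b - τ) := by
    field_simp; ring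
  have eb : 1 + d * (b - τ) / ((τ - a) * (b - τ)) = (τ + d - a) / (τ - a) := by
    field_simp; ring
  have pa : 0 ≤ (b - (τ + d)) / (b - τ) := div_nonneg (by linarith) h2.le
  have pb : 0 ≤ (τ + d - a) / (τ - a) := div_nonneg (by linarith) h1.le
  rw [lintegral_twoPoint, twoPointDensity, twoPointDensity, ea, eb, ← ENNReal.ofReal_pow pa,
    ← ENNReal.ofReal_pow pb, ← ENNReal.ofReal_mul (by positivity),
    ← ENNReal.ofReal_mul (by positivity), ← ENNReal.ofReal_add (by positivity) (by positivity)]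
  congr 1
  field_simp
  ring

end TwoPoint

/-! ### The lower bound -/

/-- This is (L - K/2)² ≥ 0. It plays the role of truncating the likelihood ratio at a level of order
K. -/
lemma le_quarter_add_sq_div {K : ℕ} (hK : 0 < K) (L : ℝ≥0∞) :
    L ≤ ENNReal.ofReal (K / 4) + L ^ 2 * ENNReal.ofReal (1 / K) := by
  have hK' : (0 : ℝ) < K := by exact_mod_cast hK
  rcases eq_or_ne L ⊤ with rfl | hL
  · simp [ENNReal.top_mul, hK]
  · obtain ⟨l, hl, rfl⟩ : ∃ l : ℝ, 0 ≤ l ∧ L = ENNReal.ofReal l :=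
      ⟨L.toReal, ENNReal.toReal_nonneg, (ENNReal.ofReal_toReal hL).symm⟩
    rw [← ENNReal.ofReal_pow hl, ← ENNReal.ofReal_mul (by positivity),
      ← ENNReal.ofReal_add (by positivity) (by positivity)]
    refine ENNReal.ofReal_le_ofReal ?_
    have : l ^ 2 * (1 / K) + K / 4 - l = (l - K / 2) ^ 2 / K := by field_simp; ring
    have h2 : 0 ≤ (l - K / 2) ^ 2 / K := by positivity
    linarith

section LowerBound

variable {K T : ℕ} (π : Strategy K T)

/-- Among `K` problems, whose arms have densities with second moment at most `V` with respect to
the same problem, the problem cannot be identified, if `V ^ T ≤ K / 2`. -/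
lemma sum_lintegral_indicator_le (hK : 0 < K) {ν : Fin K → ProbabilityMeasure ℝ}
    {ν' : Fin K → Fin K → ProbabilityMeasure ℝ} {g : Fin K → Fin K → ℝ → ℝ≥0∞}
    (hg : ∀ k j, Measurable (g k j))
    (h : ∀ k j, (ν' k j : Measure ℝ) = (ν j : Measure ℝ).withDensity (g k j)) {V : ℝ≥0∞}
    (hV : ∀ k j, ∫⁻ y, g k j y ^ 2 ∂(ν j : Measure ℝ) ≤ V) (hVT : V ^ T ≤ ENNReal.ofReal (K / 2))
    {I : Fin K → π.Seed × (Fin T → ℝ) → ℝ≥0∞} (hI : ∀ k, Measurable (I k))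
    (hI1 : ∀ z, ∑ k, I k z ≤ 1) :
    ∑ k, ∫⁻ z, I k (z.1, π.rewards z.1 z.2 T le_rfl) ∂(π.law.prod (tableLaw T (ν' k))) ≤
      ENNReal.ofReal (3 * K / 4) := by
  have hK' : (0 : ℝ) < K := by exact_mod_cast hK
  have hIs : ∀ k s, Measurable fun r => I k (s, r) := fun k s => (hI k).comp measurable_prodMk_left
  have hIm : ∀ k, Measurable fun z : π.Seed × (Fin T → Fin K → ℝ) =>
      I k (z.1, π.rewards z.1 z.2 T le_rfl) := fun k =>
    (hI k).comp (measurable_fst.prodMk (π.measurable_rewards le_rfl))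
  have hIle : ∀ k z, I k z ≤ 1 := fun k z =>
    (Finset.single_le_sum (f := fun k => I k z) (fun _ _ => zero_le) (Finset.mem_univ k)).trans
      (hI1 z)
  -- E[L I] ≤ (K/4) E[I] + E[L²] / K under the common law, and E[L²] ≤ K/2. Summed over `k`, the
  -- first terms give at most K/4.
  have key : ∀ k, ∫⁻ z, I k (z.1, π.rewards z.1 z.2 T le_rfl) ∂(π.law.prod (tableLaw T (ν' k))) ≤
      ENNReal.ofReal (K / 4) * (∫⁻ z, I k (z.1, π.rewards z.1 z.2 T le_rfl)
        ∂(π.law.prod (tableLaw T ν))) + ENNReal.ofReal (1 / 2) := by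
    intro k
    rw [lintegral_prod _ (hIm k).aemeasurable, lintegral_prod _ (hIm k).aemeasurable,
      ← lintegral_const_mul _ (hIm k).lintegral_prod_right']
    have hone : ENNReal.ofReal (1 / 2) = ∫⁻ _, ENNReal.ofReal (1 / 2) ∂π.law := by simp
    rw [hone, ← lintegral_add_right _ measurable_const]
    refine lintegral_mono fun s => ?_
    have hLm := π.measurable_likelihood (hg k) s (le_refl T)
    have hRm := π.measurable_rewards_mk s (le_refl T)
    simp only
    rw [π.lintegral_rewards_eq (hg k) (h k) s le_rfl (hIs k s)]
    calc _ ≤ ∫⁻ x, (ENNReal.ofReal (K / 4) * I k (s, π.rewards s x T le_rfl) +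
          π.likelihood (g k) s T le_rfl (π.rewards s x T le_rfl) ^ 2 * ENNReal.ofReal (1 / K))
          ∂tableLaw T ν := by
          refine lintegral_mono fun x => ?_
          refine (mul_le_mul_left (le_quarter_add_sq_div hK _) _).trans ?_
          rw [add_mul]
          exact add_le_add le_rfl (mul_le_of_le_one_right' (hIle k _))
      _ ≤ _ := by
          have hIR : Measurable fun x => I k (s, π.rewards s x T le_rfl) := (hIs k s).comp hRm
          have hLR : Measurable fun x => π.likelihood (g k) s T le_rfl (π.rewards s x T le_rfl) :=
            hLm.comp hRm
          rw [lintegral_add_left (hIR.const_mul _), lintegral_const_mul _ hIR,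
            lintegral_mul_const _ (hLR.pow_const 2)]
          gcongr
          calc _ ≤ ENNReal.ofReal (K / 2) * ENNReal.ofReal (1 / K) := by
                gcongr
                exact (π.lintegral_likelihood_sq_le (hg k) (hV k) s le_rfl).trans hVT
            _ = _ := by
                rw [← ENNReal.ofReal_mul (by positivity)]
                congr 1
                field_simp
  refine (Finset.sum_le_sum fun k _ => key k).trans ?_
  rw [Finset.sum_add_distrib, ← Finset.mul_sum, ← lintegral_finsetSum _ fun k _ => hIm k]
  calc _ ≤ ENNReal.ofReal (K / 4) * 1 + K * ENNReal.ofReal (1 / 2) := by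
        gcongr
        · calc _ ≤ ∫⁻ _, 1 ∂(π.law.prod (tableLaw T ν)) := lintegral_mono fun z => hI1 _
            _ = 1 := by simp
        · simp
    _ = _ := by
        rw [mul_one, ← ENNReal.ofReal_natCast, ← ENNReal.ofReal_mul hK'.le,
          ← ENNReal.ofReal_add (by positivity) (by positivity)]
        congr 1
        ring

/-- The lower bound, for a class that contains all problems with nondecreasing means and support
in `[a, b]`. -/
lemma le_minimaxRegret (hK : 3 ≤ K) {a b τ : ℝ} (haτ : a < τ) (hτb : τ < b)
    (hT : 12 * Real.log K ≤ T) {B : Set (Fin K → ProbabilityMeasure ℝ)}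
    (hB : ∀ ν : Fin K → ProbabilityMeasure ℝ, (∀ k, ∀ᵐ x ∂(ν k : Measure ℝ), x ∈ Set.Icc a b) →
      (Monotone fun k => mean (ν k)) → ν ∈ B) :
    ENNReal.ofReal (1 / 8 * ((τ - a) * (b - τ) / (b - a)) * √(Real.log K / T)) ≤
      minimaxRegret T τ B := by
  classical
  have hab : a < b := haτ.trans hτb
  have h0 : 0 < b - a := by linarith
  have h1 : 0 < τ - a := by linarith
  have h2 : 0 < b - τ := by linarith
  have hlog := MTB.one_le_log hK
  have hTpos : (0 : ℝ) < T := by linarith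
  have hKpos : (0 : ℝ) < K := by positivity
  set w := (τ - a) * (b - τ) / (b - a) with hw
  have hwpos : 0 < w := by positivity
  set Δ := w * √(Real.log K / T) / 2 with hΔ
  -- The lower bound on `T` keeps Δ ≤ w ≤ min (τ - a) (b - τ), so the means τ ± Δ stay in [a, b].
  have hsqrt : √(Real.log K / T) ≤ 1 := by
    rw [Real.sqrt_le_one, div_le_one hTpos]
    linarith
  have hΔ0 : 0 ≤ Δ := by positivity
  have hΔw : Δ ≤ w := by rw [hΔ]; nlinarith
  have hwa : w ≤ τ - a := by
    rw [hw, div_le_iff₀ h0]; nlinarith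
  have hwb : w ≤ b - τ := by
    rw [hw, div_le_iff₀ h0]; nlinarith
  -- The variance equals w (b - a), and 4 w ≤ b - a by the inequality of arithmetic and geometric
  -- means.
  have hvar : Δ ^ 2 / ((τ - a) * (b - τ)) ≤ Real.log K / (16 * T) := by
    have e1 : Δ ^ 2 = w ^ 2 * (Real.log K / T) / 4 := by
      rw [hΔ, div_pow, mul_pow, Real.sq_sqrt (by positivity)]
      norm_num
    have e2 : (τ - a) * (b - τ) = w * (b - a) := by rw [hw]; field_simp
    have e3 : 4 * w ≤ b - a := by
      rw [hw, ← mul_div_assoc, div_le_iff₀ h0]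
      nlinarith [sq_nonneg ((τ - a) - (b - τ))]
    rw [e1, e2, div_le_iff₀ (by positivity)]
    have e4 : Real.log K / (16 * T) * (w * (b - a)) = (Real.log K / T * w / 16) * (b - a) := by
      field_simp
    have e5 : w ^ 2 * (Real.log K / T) / 4 = (Real.log K / T * w / 16) * (4 * w) := by ring
    rw [e4, e5]
    gcongr
  let sgn : Fin K → Fin K → ℝ := fun k j => if k ≤ j then Δ else -Δ
  have hsgn : ∀ k j, |sgn k j| = Δ := by
    intro k j
    simp only [sgn]
    split_ifs
    · exact abs_of_nonneg hΔ0
    · rw [abs_neg, abs_of_nonneg hΔ0]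
  have hsa : ∀ k j, a ≤ τ + sgn k j := fun k j => by
    have := (abs_le.1 (hsgn k j).le).1
    linarith
  have hsb : ∀ k j, τ + sgn k j ≤ b := fun k j => by
    have := (abs_le.1 (hsgn k j).le).2
    linarith
  let ν : Fin K → ProbabilityMeasure ℝ := fun _ =>
    ⟨twoPoint a b τ, isProbabilityMeasure_twoPoint hab haτ.le hτb.le⟩
  let ν' : Fin K → Fin K → ProbabilityMeasure ℝ := fun k j =>
    ⟨twoPoint a b (τ + sgn k j), isProbabilityMeasure_twoPoint hab (hsa k j) (hsb k j)⟩
  have hmean : ∀ k j, mean (ν' k j) = τ + sgn k j := fun k j =>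
    integral_twoPoint hab (hsa k j) (hsb k j)
  have hmem : ∀ k, ν' k ∈ B := by
    intro k
    refine hB _ (fun j => ae_twoPoint hab.le) fun i j hij => ?_
    simp only [hmean, sgn]
    split_ifs with hi hj
    · exact le_rfl
    · exact absurd (hi.trans hij) hj
    · linarith
    · exact le_rfl
  refine le_iInf fun π => ?_
  let I : Fin K → π.Seed × (Fin T → ℝ) → ℝ≥0∞ := fun k z =>
    if π.guess z = fun j => decide (k ≤ j) then 1 else 0
  have hI : ∀ k, Measurable (I k) := fun k =>
    Measurable.ite (π.measurable_guess (measurableSet_singleton _)) measurable_const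
      measurable_const
  have hI1 : ∀ z, ∑ k, I k z ≤ 1 := by
    intro z
    by_cases hz : ∃ k, π.guess z = fun j => decide (k ≤ j)
    · obtain ⟨k, hk⟩ := hz
      rw [Finset.sum_eq_single k]
      · simp [I, hk]
      · intro l _ hlk
        simp only [I]
        rw [if_neg]
        intro hl
        rw [hk] at hl
        have e1 := congrFun hl k
        have e2 := congrFun hl l
        simp only [le_refl, decide_true, true_eq_decide_iff, decide_eq_true_eq] at e1 e2
        exact hlk (le_antisymm e1 e2)
      · simp
    · push Not at hz
      simp [I, hz]
  -- The left side is at most K ^ (1/16), which is below K / 2 because log K ≥ 1.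
  have hVT : ENNReal.ofReal (1 + Real.log K / (16 * T)) ^ T ≤ ENNReal.ofReal (K / 2) := by
    rw [← ENNReal.ofReal_pow (by positivity)]
    refine ENNReal.ofReal_le_ofReal ?_
    have e1 : (1 + Real.log K / (16 * T)) ^ T ≤ Real.exp (Real.log K / 16) := by
      calc _ ≤ Real.exp (Real.log K / (16 * T)) ^ T := by
            gcongr
            linarith [Real.add_one_le_exp (Real.log K / (16 * T))]
        _ = _ := by
            rw [← Real.exp_nat_mul]
            congr 1
            field_simp
    refine e1.trans ?_
    have e2 : (K : ℝ) / 2 = Real.exp (Real.log K - Real.log 2) := by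
      rw [Real.exp_sub, Real.exp_log hKpos, Real.exp_log (by norm_num)]
    rw [e2]
    refine Real.exp_le_exp.2 ?_
    have := Real.log_two_lt_d9
    linarith
  have hsum := sum_lintegral_indicator_le π (by omega) (ν := ν) (ν' := ν')
    (g := fun k j => twoPointDensity a b τ (sgn k j))
    (fun k j => measurable_twoPointDensity _ _ _ _)
    (fun k j => twoPoint_eq_withDensity haτ hτb)
    (fun k j => (lintegral_twoPointDensity_sq haτ hτb (hsa k j) (hsb k j)).trans_le
      (ENNReal.ofReal_le_ofReal (by
        rw [← sq_abs, hsgn]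
        linarith))) hVT hI hI1
  -- All gaps equal Δ, so any output that is not exactly right costs Δ.
  have hpt : ∀ k z, ENNReal.ofReal Δ ≤ regret τ (ν' k) (π.guess z) + ENNReal.ofReal Δ * I k z := by
    intro k z
    by_cases hz : π.guess z = fun j => decide (k ≤ j)
    · simp [I, hz]
    · refine le_add_right ?_
      obtain ⟨j, hj⟩ := Function.ne_iff.1 hz
      rcases hΔ0.eq_or_lt with h | hΔpos
      · simp [← h]
      have hmis : ¬(π.guess z j = true ↔ τ ≤ mean (ν' k j)) := by
        intro hiff
        apply hj
        rw [hmean] at hiff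
        have hle : τ ≤ τ + sgn k j ↔ k ≤ j := by
          simp only [sgn]
          split_ifs with hkj
          · simp [hkj, hΔ0]
          · simp [hkj, hΔpos]
        rw [hle] at hiff
        rw [Bool.eq_iff_iff, hiff, decide_eq_true_eq]
      refine le_trans (le_of_eq ?_) (le_iSup₂ (f := fun (j : Fin K)
        (_ : ¬(π.guess z j = true ↔ τ ≤ mean (ν' k j))) =>
          ENNReal.ofReal |τ - mean (ν' k j)|) j hmis)
      rw [hmean, sub_add_cancel_left, abs_neg, hsgn]
  have hone : ∀ k, ENNReal.ofReal Δ ≤ worstRegret τ B π + ENNReal.ofReal Δ *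
      ∫⁻ z, I k (z.1, π.rewards z.1 z.2 T le_rfl) ∂(π.law.prod (tableLaw T (ν' k))) := by
    intro k
    have hIm : Measurable fun z : π.Seed × (Fin T → Fin K → ℝ) =>
        I k (z.1, π.rewards z.1 z.2 T le_rfl) :=
      (hI k).comp (measurable_fst.prodMk (π.measurable_rewards le_rfl))
    calc ENNReal.ofReal Δ = ∫⁻ _, ENNReal.ofReal Δ ∂(π.law.prod (tableLaw T (ν' k))) := by simp
      _ ≤ ∫⁻ z, (regret τ (ν' k) (π.guess (z.1, π.rewards z.1 z.2 T le_rfl)) +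
          ENNReal.ofReal Δ * I k (z.1, π.rewards z.1 z.2 T le_rfl))
          ∂(π.law.prod (tableLaw T (ν' k))) := lintegral_mono fun z => hpt k _
      _ = expRegret τ (ν' k) π + _ := by
          rw [lintegral_add_right _ (hIm.const_mul _), lintegral_const_mul _ hIm]
          rfl
      _ ≤ _ := by
          gcongr
          exact le_iSup₂ (f := fun ν (_ : ν ∈ B) => expRegret τ ν π) (ν' k) (hmem k)
  have htot := Finset.sum_le_sum fun (k : Fin K) (_ : k ∈ Finset.univ) => hone k
  rw [Finset.sum_add_distrib, ← Finset.mul_sum] at htot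
  simp only [Finset.sum_const, Finset.card_univ, Fintype.card_fin, nsmul_eq_mul] at htot
  by_contra hcon
  push Not at hcon
  -- Summing over `k` gives K Δ ≤ K R + (3/4) K Δ for the worst regret R, hence R ≥ Δ / 4.
  have hlt : (K : ℝ≥0∞) * worstRegret τ B π < K * ENNReal.ofReal (Δ / 4) := by
    refine (ENNReal.mul_lt_mul_iff_right (by simp; omega) (ENNReal.natCast_ne_top K)).2 ?_
    convert hcon using 2
    rw [hΔ]
    ring
  have hfin : ENNReal.ofReal Δ * ENNReal.ofReal (3 * K / 4) ≠ ⊤ :=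
    ENNReal.mul_ne_top ENNReal.ofReal_ne_top ENNReal.ofReal_ne_top
  have hlt2 := htot.trans_lt (lt_of_le_of_lt (add_le_add_right (mul_le_mul_right hsum _) _)
    (ENNReal.add_lt_add_right hfin hlt))
  rw [← ENNReal.ofReal_natCast, ← ENNReal.ofReal_mul hKpos.le, ← ENNReal.ofReal_mul hKpos.le,
    ← ENNReal.ofReal_mul hΔ0, ← ENNReal.ofReal_add (by positivity) (by positivity)] at hlt2
  refine absurd hlt2 (not_lt.2 (ENNReal.ofReal_le_ofReal (le_of_eq ?_)))
  ring

end LowerBound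

end ThresholdBandit

/-! ### Assembly of the bounds for both classes -/

theorem theorem2 :
    ∃ c : ℝ, 0 < c ∧
      -- arms supported in `[0,1]`
      (∀ (τ : ℝ) (K T : ℕ) (hK : 3 ≤ K), τ ∈ Set.Ioo (0 : ℝ) 1 → 12 * Real.log K ≤ T →
        ENNReal.ofReal (c * (τ * (1 - τ)) * √(Real.log K / T)) ≤
            ThresholdBandit.minimaxRegret T τ (ThresholdBandit.boundedMonotone K) ∧
          ThresholdBandit.minimaxRegret T τ (ThresholdBandit.boundedMonotone K) ≤
            ENNReal.ofReal (80 * √(Real.log K / T)) ∧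
          ThresholdBandit.worstRegret τ (ThresholdBandit.boundedMonotone K)
              (ThresholdBandit.mtb K T (by omega) τ 1) ≤
            ENNReal.ofReal (80 * √(Real.log K / T))) ∧
      -- `σ²`-sub-Gaussian arms
      (∀ (σ τ : ℝ) (K T : ℕ) (hK : 3 ≤ K), 0 < σ → 3 * ⌈6 * Real.log K⌉₊ ≤ T →
        ENNReal.ofReal (c * √(σ ^ 2 * Real.log K / T)) ≤
            ThresholdBandit.minimaxRegret T τ (ThresholdBandit.subGaussianMonotone K σ) ∧
          ThresholdBandit.minimaxRegret T τ (ThresholdBandit.subGaussianMonotone K σ) ≤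
            ENNReal.ofReal (80 * √(σ ^ 2 * Real.log K / T)) ∧
          ThresholdBandit.worstRegret τ (ThresholdBandit.subGaussianMonotone K σ)
              (ThresholdBandit.mtb K T (by omega) τ σ) ≤
            ENNReal.ofReal (80 * √(σ ^ 2 * Real.log K / T))) := by
  -- The sub-Gaussian class dictates this value: on [τ - σ, τ + σ] the factor (τ - a) (b - τ) / (b -
  -- a) is σ / 2, multiplied by 1 / 8.
  refine ⟨1 / 16, by norm_num, ?_, ?_⟩
  · intro τ K T hK hτ hT
    have hup := ThresholdBandit.worstRegret_mtb_boundedMonotone_le (hK := by omega) hK hτ hT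
    refine ⟨?_, (iInf_le _ _).trans hup, hup⟩
    refine le_trans (ENNReal.ofReal_le_ofReal ?_) (ThresholdBandit.le_minimaxRegret (a := 0)
      (b := 1) hK hτ.1 hτ.2 hT fun ν h1 h2 => ⟨h1, h2⟩)
    rw [sub_zero, sub_zero, div_one]
    have := mul_pos hτ.1 (sub_pos.2 hτ.2)
    gcongr
    norm_num
  · intro σ τ K T hK hσ hT
    have hlog := ThresholdBandit.MTB.one_le_log hK
    have hceil : 6 * Real.log K ≤ ⌈6 * Real.log K⌉₊ := Nat.le_ceil _
    have hT₂ : 0 < ThresholdBandit.MTB.T₂ K T := by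
      refine Nat.div_pos hT (Nat.mul_pos (by norm_num) (Nat.ceil_pos.2 (by positivity)))
    have hT' : 12 * Real.log K ≤ T := by
      have h1 : (3 * ⌈6 * Real.log K⌉₊ : ℝ) ≤ T := by exact_mod_cast hT
      linarith
    have hup := ThresholdBandit.MTB.worstRegret_mtb_le (hK := by omega) (τ := τ) hK hσ hT₂
    refine ⟨?_, (iInf_le _ _).trans hup, hup⟩
    refine le_trans (ENNReal.ofReal_le_ofReal (le_of_eq ?_)) (ThresholdBandit.le_minimaxRegret
      (a := τ - σ) (b := τ + σ) hK (by linarith) (by linarith) hT' fun ν h1 h2 =>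
        ⟨fun k => ThresholdBandit.hasSubgaussianMGF_of_support (a := τ - σ) (b := τ + σ)
          (by rw [abs_of_pos] <;> linarith) (h1 k), h2⟩)
    rw [mul_div_assoc, Real.sqrt_mul (sq_nonneg σ), Real.sqrt_sq hσ.le,
      show τ - (τ - σ) = σ by ring, show τ + σ - τ = σ by ring,
      show τ + σ - (τ - σ) = 2 * σ by ring]
    field_simp
    ring
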